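/- Let $\theta$ be a permutation of $\{1,\dots,m\}\times\{1,\dots,n\}$ and let $\mathbb{F}_\theta^+$ be the unital semigroup generated by $e_1,\dots,e_m,f_1,\dots,f_n$ subject to $e_if_j=f_{j'}e_{i'}$ whenever $\theta(i,j)=(i',j')$. For words $u=i_1\cdots i_k$, $v=j_1\cdots j_l$ put $e_u=e_{i_1}\cdots e_{i_k}$ and $f_v=f_{j_1}\cdots f_{j_l}$. A $*$-representation $\pi$ of $\mathbb{F}_\theta^+$ is a representation by isometries on a complex Hilbert space with $\sum_i\pi(e_i)\pi(e_i)^*=I=\sum_j\pi(f_j)\pi(f_j)^*$. It is atomic if there is an orthonormal basis $(\xi_x)$ such that every $\pi(w)$ maps every basis vector to a scalar in $\mathbb{T}\cup\{0\}$ times a basis vector. Its graph has the lines $\dot\xi_x=\mathbb{C}\xi_x$ as vertices, a blue edge labelled $i$ from $\dot\xi$ to $\dot\zeta$ if $\pi(e_i)\dot\xi=\dot\zeta$, and a red edge labelled $j$ if $\pi(f_j)\dot\xi=\dot\zeta$. An atomic $*$-representation with nonempty connected graph is of type 3bi if (1) all blue and all red components of the graph are of infinite tail type, i.e. pulling back from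 any vertex along blue edges (respectively, along red edges) never repeats a vertex, and (2) there are vertices $\dot\xi_0,\dot\zeta_0$ and nonempty words $u_0,v_0$ with $\pi(e_{u_0})\dot\xi_0=\dot\zeta_0$ and $\pi(f_{v_0})\dot\zeta_0=\dot\xi_0$, where $l=|v_0|$ is the exact period of blue components at $\dot\xi_0$, i.e. the least positive number of red steps which, pulled back from $\dot\xi_0$, lead to a vertex in the blue component of $\dot\xi_0$. Say that such a $\pi$ has data $(u_0,v_0,\beta)$ at the basis vector $\xi$, where $u_0\in\{1,\dots,m\}^k$ and $v_0\in\{1,\dots,n\}^l$ with $k,l>0$ and $\beta\in\mathbb{T}$, if $l$ is the exact period of blue components at $\dot\xi$ and $\pi(e_{u_0}f_{v_0})\xi=\beta\xi$. (a) Every atomic $*$-representation of type 3bi has data $(u_0,v_0,\beta)$ at some basis vector. The data determine the representation up to unitary equivalence: if $\pi$ and $\pi'$ are of type 3bi and have the same data at basis vectors $\xi$ and $\xi'$, then there is a unitary $U$ with $U\xi=\xi'$ and $U\pi(w)=\pi'(w)U$ for all $w$. (b) Conversely, for all nonempty words $u_0,v_0$ and every $\beta\in\mathbb{T}$ there is an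 atomic $*$-representation of type 3bi with data $(u_0,v_0,\beta)$ at some basis vector. (c) Let $\pi$ be of type 3bi with data $(u_0,v_0,\beta)$ at $\xi$, let $k=|u_0|$, $l=|v_0|$, $G=\mathbb{Z}^2/\mathbb{Z}(k,l)$, and write $[s,t]$ for the class of $(s,t)$ in $G$. There are distinct vertices $\dot\xi_g$ $(g\in G)$ with $\dot\xi_{[0,0]}=\dot\xi$, and labels $i_g,j_g$, such that $\pi(e_{i_g})\dot\xi_g=\dot\xi_{g+[1,0]}$ and $\pi(f_{j_g})\dot\xi_g=\dot\xi_{g+[0,1]}$ for all $g\in G$. For any such system there is an integer $p>0$ with \[ i_{[s-p,t]}=i_{[s,t]}\quad\text{and}\quad j_{[s-p,t]}=j_{[s,t]}\qquad\text{for all }s,t\in\mathbb{Z}, \] and the symmetry group $H_\pi$, consisting of all $h\in G$ for which there is $T\in\mathbb{Z}$ with $i_{[s,t]+h}=i_{[s,t]}$ and $j_{[s,t]+h}=j_{[s,t]}$ for all $s,t\le T$, is nonzero. (d) A representation of type 3bi is never irreducible: there is a closed subspace other than $\{0\}$ and the whole space which is invariant under all $\pi(w)$ and $\pi(w)^*$.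 -/

import Mathlib

open scoped BigOperators

noncomputable section

namespace TwoGraph

/-- The defining relations `e_i f_j = f_{j'} e_{i'}`, where `θ (i, j) = (i', j')`;
`Sum.inl i` is the letter `e_i` and `Sum.inr j` is the letter `f_j`. -/
inductive Rel {m n : ℕ} (θ : Equiv.Perm (Fin m × Fin n)) :
    FreeMonoid (Fin m ⊕ Fin n) → FreeMonoid (Fin m ⊕ Fin n) → Prop
  | comm (i : Fin m) (j : Fin n) :
      Rel θ (FreeMonoid.of (Sum.inl i) * FreeMonoid.of (Sum.inr j))
        (FreeMonoid.of (Sum.inr (θ (i, j)).2) * FreeMonoid.of (Sum.inl (θ (i, j)).1))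

/-- The unital semigroup `𝔽_θ⁺`. -/
abbrev Semi {m n : ℕ} (θ : Equiv.Perm (Fin m × Fin n)) : Type := PresentedMonoid (Rel θ)

/-- The generator `e_i`. -/
def e {m n : ℕ} (θ : Equiv.Perm (Fin m × Fin n)) (i : Fin m) : Semi θ :=
  PresentedMonoid.of (Rel θ) (Sum.inl i)

/-- The generator `f_j`. -/
def f {m n : ℕ} (θ : Equiv.Perm (Fin m × Fin n)) (j : Fin n) : Semi θ :=
  PresentedMonoid.of (Rel θ) (Sum.inr j)

/-- The element `e_u = e_{i_1} ⋯ e_{i_k}` of a word `u = i_1 … i_k`. -/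
def eWord {m n : ℕ} (θ : Equiv.Perm (Fin m × Fin n)) (u : List (Fin m)) : Semi θ :=
  (u.map (e θ)).prod

/-- The element `f_v = f_{j_1} ⋯ f_{j_l}` of a word `v = j_1 … j_l`. -/
def fWord {m n : ℕ} (θ : Equiv.Perm (Fin m × Fin n)) (v : List (Fin n)) : Semi θ :=
  (v.map (f θ)).prod

section Representations

variable {m n : ℕ} {θ : Equiv.Perm (Fin m × Fin n)} {ι H : Type*}
  [NormedAddCommGroup H] [InnerProductSpace ℂ H]

/-- A `*`-representation: isometric and defect free. -/
structure IsStarRep [CompleteSpace H] (π : Semi θ →* (H →L[ℂ] H)) : Prop where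
  isometry : ∀ w, Isometry (π w)
  defect_e : ∑ i, π (e θ i) ∘L ContinuousLinearMap.adjoint (π (e θ i)) = 1
  defect_f : ∑ j, π (f θ j) ∘L ContinuousLinearMap.adjoint (π (f θ j)) = 1

/-- Every `π w` permutes the orthonormal basis `b` up to scalars in `𝕋 ∪ {0}`. -/
def IsAtomic (π : Semi θ →* (H →L[ℂ] H)) (b : HilbertBasis ι ℂ H) : Prop :=
  ∀ (w : Semi θ) (x : ι), ∃ (y : ι) (c : ℂ), (‖c‖ = 1 ∨ c = 0) ∧ π w (b x) = c • b y

/-- `π w` carries the line `ℂ b_x` onto the line `ℂ b_y`. -/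
def Carries (π : Semi θ →* (H →L[ℂ] H)) (b : HilbertBasis ι ℂ H) (w : Semi θ)
    (x y : ι) : Prop :=
  ∃ c : ℂ, c ≠ 0 ∧ π w (b x) = c • b y

/-- There is a blue edge from `x` to `y` in the graph of the representation. -/
def BlueEdge (π : Semi θ →* (H →L[ℂ] H)) (b : HilbertBasis ι ℂ H) (x y : ι) : Prop :=
  ∃ i, Carries π b (e θ i) x y

/-- There is a red edge from `x` to `y` in the graph of the representation. -/
def RedEdge (π : Semi θ →* (H →L[ℂ] H)) (b : HilbertBasis ι ℂ H) (x y : ι) : Prop :=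
  ∃ j, Carries π b (f θ j) x y

/-- The graph of the representation is nonempty and connected (directions of edges ignored). -/
def GraphConnected (π : Semi θ →* (H →L[ℂ] H)) (b : HilbertBasis ι ℂ H) : Prop :=
  Nonempty ι ∧
    ∀ x y, Relation.EqvGen (fun x y => BlueEdge π b x y ∨ RedEdge π b x y) x y

/-- `x` and `y` lie in the same blue component. -/
def SameBlue (π : Semi θ →* (H →L[ℂ] H)) (b : HilbertBasis ι ℂ H) (x y : ι) : Prop :=
  Relation.EqvGen (BlueEdge π b) x y

/-- All components of the one-coloured graph `R` are of infinite tail type: pulling back from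
any vertex along the edges runs through infinitely many distinct vertices. -/
def AllTails (R : ι → ι → Prop) : Prop :=
  ∀ x, ∃ z : ℕ → ι, z 0 = x ∧ Function.Injective z ∧ ∀ k, R (z (k + 1)) (z k)

/-- Pulling back `l > 0` red steps from `x` leads to a vertex in the blue component of `x`. -/
def RedReturns (π : Semi θ →* (H →L[ℂ] H)) (b : HilbertBasis ι ℂ H) (x : ι) (l : ℕ) : Prop :=
  0 < l ∧ ∃ (y : ι) (v : List (Fin n)),
    v.length = l ∧ Carries π b (fWord θ v) y x ∧ SameBlue π b y x

/-- The sequence of blue components met when pulling back from `x` along the red edges returns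
to the component of `x`, for the first time after `l` steps. -/
def HasBluePeriod (π : Semi θ →* (H →L[ℂ] H)) (b : HilbertBasis ι ℂ H)
    (x : ι) (l : ℕ) : Prop :=
  IsLeast {l' : ℕ | RedReturns π b x l'} l

/-- An atomic `*`-representation (with connected graph) of type 3bi: tail by tail, the blue
components repeat after `l = |v₀|` steps, and the return is below the start. -/
structure IsType3bi [CompleteSpace H] (π : Semi θ →* (H →L[ℂ] H))
    (b : HilbertBasis ι ℂ H) : Prop where
  starRep : IsStarRep π
  atomic : IsAtomic π b
  connected : GraphConnected π b
  blue_tail : AllTails (BlueEdge π b)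
  red_tail : AllTails (RedEdge π b)
  return_below : ∃ (x₀ z₀ : ι) (u₀ : List (Fin m)) (v₀ : List (Fin n)),
    u₀ ≠ [] ∧ HasBluePeriod π b x₀ v₀.length ∧
      Carries π b (eWord θ u₀) x₀ z₀ ∧ Carries π b (fWord θ v₀) z₀ x₀

/-- The words `u₀, v₀` and the scalar `β` are read off from `π` at the basis vector `b x`. -/
structure HasData (π : Semi θ →* (H →L[ℂ] H)) (b : HilbertBasis ι ℂ H)
    (u₀ : List (Fin m)) (v₀ : List (Fin n)) (β : Circle) (x : ι) : Prop where
  ne_nil : u₀ ≠ []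
  period : HasBluePeriod π b x v₀.length
  eigen : π (eWord θ u₀ * fWord θ v₀) (b x) = (β : ℂ) • b x

/-- The group `ℤ² / ℤ(k, l)`. -/
abbrev Grp (k l : ℕ) : Type := (ℤ × ℤ) ⧸ AddSubgroup.zmultiples ((k : ℤ), (l : ℤ))

/-- The class `[s, t]` of `(s, t)` in `ℤ² / ℤ(k, l)`. -/
def cls (k l : ℕ) (s t : ℤ) : Grp k l := QuotientAddGroup.mk (s, t)

/-- The distinct basis lines `ξ_g`, `g ∈ ℤ²/ℤ(k, l)`, with `ξ_{[0,0]} = x`, and the labels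
`i_g`, `j_g` of the blue edge from `ξ_g` to `ξ_{g + [1,0]}` and of the red edge from `ξ_g` to
`ξ_{g + [0,1]}`. -/
structure IsGrid (π : Semi θ →* (H →L[ℂ] H)) (b : HilbertBasis ι ℂ H) (x : ι) (k l : ℕ)
    (ξ : Grp k l → ι) (i : Grp k l → Fin m) (j : Grp k l → Fin n) : Prop where
  injective : Function.Injective ξ
  base : ξ (cls k l 0 0) = x
  blue : ∀ g, Carries π b (e θ (i g)) (ξ g) (ξ (g + cls k l 1 0))
  red : ∀ g, Carries π b (f θ (j g)) (ξ g) (ξ (g + cls k l 0 1))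

/-- No closed subspaces except `0` and `H` reduce `π`. -/
def IsIrreducible [CompleteSpace H] (π : Semi θ →* (H →L[ℂ] H)) : Prop :=
  ∀ K : Submodule ℂ H, IsClosed (K : Set H) →
    (∀ w, ∀ η ∈ K, π w η ∈ K ∧ ContinuousLinearMap.adjoint (π w) η ∈ K) → K = ⊥ ∨ K = ⊤

end Representations

/-- The symmetry group `H_π` in `ℤ²/ℤ(k, l)` of the data `(i, j)`: all `h` such that translation
by `h` preserves the labels at all `[s, t]` with `s, t ≤ T`, for some `T`. -/
def symGroup {m n k l : ℕ} (i : Grp k l → Fin m) (j : Grp k l → Fin n) :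
    AddSubgroup (Grp k l) where
  carrier := {h | ∃ T : ℤ, ∀ s t : ℤ, s ≤ T → t ≤ T →
    i (cls k l s t + h) = i (cls k l s t) ∧ j (cls k l s t + h) = j (cls k l s t)}
  zero_mem' := ⟨0, fun s t _ _ => by simp⟩
  add_mem' := by
    rintro h h' ⟨T, hT⟩ ⟨T', hT'⟩
    obtain ⟨⟨a, c⟩, rfl⟩ := QuotientAddGroup.mk_surjective h
    refine ⟨min T' (min T (min (T' - a) (min (T - a) (min (T' - c) (T - c))))), ?_⟩
    intro s t hs ht
    simp only [le_min_iff] at hs ht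
    have e1 : cls k l s t + (QuotientAddGroup.mk (a, c) : Grp k l) = cls k l (s + a) (t + c) := rfl
    have h1 := hT s t (by omega) (by omega)
    have h2 := hT' (s + a) (t + c) (by omega) (by omega)
    rw [← add_assoc, e1]
    rw [e1] at h1
    exact ⟨h2.1.trans h1.1, h2.2.trans h1.2⟩
  neg_mem' := by
    rintro h ⟨T, hT⟩
    obtain ⟨⟨a, c⟩, rfl⟩ := QuotientAddGroup.mk_surjective h
    refine ⟨min (T + a) (T + c), ?_⟩
    intro s t hs ht
    simp only [le_min_iff] at hs ht
    have e1 : cls k l s t + -(QuotientAddGroup.mk (a, c) : Grp k l)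
        = cls k l (s - a) (t - c) := by
      rw [← sub_eq_add_neg]; rfl
    have e2 : cls k l (s - a) (t - c) + (QuotientAddGroup.mk (a, c) : Grp k l)
        = cls k l s t := by
      rw [← e1, neg_add_cancel_right]
    have h1 := hT (s - a) (t - c) (by omega) (by omega)
    rw [e2] at h1
    rw [e1]
    exact ⟨h1.1.symm, h1.2.symm⟩

end TwoGraph

end

/-!
The proof turns an atomic representation into an action of `𝔽_θ⁺` on the vertices of its graph.
Isometry and defect zero say that every vertex is the head of exactly one blue and exactly one red
edge (`TwoGraph.IsStarRep.isCover`), so one can pull back along blue and red edges, and the two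
pullbacks commute. At a vertex `x` with data, pulling back by `(k, l)` returns to `x`, and
minimality of `l` together with the infinite tails shows that two pullbacks of `x` agree only if
their degrees agree modulo `(k, l)` (`TwoGraph.IsCover.IsRecurrent.back_eq_iff`). This gives the
grid of vertices indexed by `ℤ² / ℤ(k, l)`.

*The data determine the representation.* With `z = e_{u₀} f_{v₀}`, every vertex has the form `w x`,
and `w x = w' x` holds exactly if `w z ^ N = w' z ^ M` for some `N` and `M`, a condition on the
semigroup alone (`TwoGraph.IsCover.IsRecurrent.act_eq_iff`). Since `π(z) ξ = β ξ`, the scalars are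
determined as well, and `π(w) ξ ↦ π'(w) ξ'` extends to a unitary (`TwoGraph.exists_unitary`).

*Existence.* The same description is a construction: let `𝔽_θ⁺` act on its quotient by `w z ∼ w`,
and let every blue edge carry a `k`-th root of `β`. That the action has unique incoming edges rests
on left cancellation of letters, obtained from the action on normal forms `e_u f_v`; the degree
modulo `(k, l)` separates enough vertices to give infinite tails and the exact period `l`.

*Periodicity.* The labels along a loop of `l` red and `k` blue edges determine, through `θ`, those of
the loops one step to the left and to the right. There are finitely many labellings of a loop, so
two loops agree, and then the whole labelling is periodic (`TwoGraph.exists_period`).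

*Reducibility.* Moving the loop from `x` to the tail of its incoming blue edge turns `e_i r` into
`r e_i` and keeps the scalar `β`. By finiteness two different vertices have the same data, so by
uniqueness some unitary commutes with the representation and carries one basis vector to another.
It is not a scalar, and the kernel of a continuous function of it is a proper reducing subspace.
-/

noncomputable section

namespace TwoGraph

/-! ### The semigroup: normal forms, degrees and cancellation -/

section Semigroup

variable {m n : ℕ} {θ : Equiv.Perm (Fin m × Fin n)}

theorem e_mul_f (i : Fin m) (j : Fin n) :
    e θ i * f θ j = f θ (θ (i, j)).2 * e θ (θ (i, j)).1 :=
  PresentedMonoid.mk_eq_mk_of_rel (Rel.comm i j)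

theorem f_mul_e (j : Fin n) (i : Fin m) :
    f θ j * e θ i = e θ (θ.symm (i, j)).1 * f θ (θ.symm (i, j)).2 := by
  rw [e_mul_f]; simp

/-- The homomorphism out of `𝔽_θ⁺` with prescribed values on the generators. -/
def liftSemi {M : Type*} [Monoid M] (a : Fin m → M) (c : Fin n → M)
    (h : ∀ i j, a i * c j = c (θ (i, j)).2 * a (θ (i, j)).1) : Semi θ →* M :=
  PresentedMonoid.lift (Sum.elim a c) (by
    rintro _ _ ⟨i, j⟩
    simpa using h i j)

@[elab_as_elim]
theorem semi_induction {p : Semi θ → Prop} (one : p 1) (he : ∀ i w, p w → p (e θ i * w))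
    (hf : ∀ j w, p w → p (f θ j * w)) (w : Semi θ) : p w := by
  obtain ⟨a, rfl⟩ := PresentedMonoid.surjective_mk w
  induction a using FreeMonoid.inductionOn' with
  | one => exact one
  | of_mul x xs ih =>
    rw [map_mul]
    rcases x with i | j
    · exact he i _ ih
    · exact hf j _ ih

@[simp] theorem eWord_nil : eWord θ [] = 1 := rfl
@[simp] theorem fWord_nil : fWord θ [] = 1 := rfl
@[simp] theorem eWord_cons (i : Fin m) (u : List (Fin m)) :
    eWord θ (i :: u) = e θ i * eWord θ u := by simp [eWord]
@[simp] theorem fWord_cons (j : Fin n) (v : List (Fin n)) :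
    fWord θ (j :: v) = f θ j * fWord θ v := by simp [fWord]

theorem exists_f_mul_eWord (j : Fin n) (u : List (Fin m)) :
    ∃ u' j', u'.length = u.length ∧ f θ j * eWord θ u = eWord θ u' * f θ j' := by
  induction u generalizing j with
  | nil => exact ⟨[], j, by simp⟩
  | cons i u ih =>
    obtain ⟨u', j', hl, h⟩ := ih (θ.symm (i, j)).2
    refine ⟨(θ.symm (i, j)).1 :: u', j', by simp [hl], ?_⟩
    rw [eWord_cons, ← mul_assoc, f_mul_e, mul_assoc, h, eWord_cons, mul_assoc]

theorem exists_e_mul_fWord (i : Fin m) (v : List (Fin n)) :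
    ∃ v' i', v'.length = v.length ∧ e θ i * fWord θ v = fWord θ v' * e θ i' := by
  induction v generalizing i with
  | nil => exact ⟨[], i, by simp⟩
  | cons j v ih =>
    obtain ⟨v', i', hl, h⟩ := ih (θ (i, j)).1
    refine ⟨(θ (i, j)).2 :: v', i', by simp [hl], ?_⟩
    rw [fWord_cons, ← mul_assoc, e_mul_f, mul_assoc, h, fWord_cons, mul_assoc]

theorem eWord_mul_fWord (u : List (Fin m)) (v : List (Fin n)) :
    ∃ u' v', u'.length = u.length ∧ v'.length = v.length ∧
      eWord θ u * fWord θ v = fWord θ v' * eWord θ u' := by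
  induction u with
  | nil => exact ⟨[], v, by simp⟩
  | cons i u ih =>
    obtain ⟨u', v', hu, hv, h⟩ := ih
    obtain ⟨v'', i', hv', h'⟩ := exists_e_mul_fWord (θ := θ) i v'
    refine ⟨i' :: u', v'', by simp [hu], hv'.trans hv, ?_⟩
    rw [eWord_cons, mul_assoc, h, ← mul_assoc, h', eWord_cons, mul_assoc]

/-- Every element has a normal form with the blue letters in front. -/
theorem exists_eq_eWord_mul_fWord (w : Semi θ) : ∃ u v, w = eWord θ u * fWord θ v := by
  induction w using semi_induction with
  | one => exact ⟨[], [], by simp⟩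
  | he i w ih =>
    obtain ⟨u, v, rfl⟩ := ih
    exact ⟨i :: u, v, by simp [mul_assoc]⟩
  | hf j w ih =>
    obtain ⟨u, v, rfl⟩ := ih
    obtain ⟨u', j', -, h⟩ := exists_f_mul_eWord (θ := θ) j u
    exact ⟨u', j' :: v, by rw [← mul_assoc, h, fWord_cons, mul_assoc]⟩

/-- The number of blue letters of an element. -/
def blueDeg : Semi θ →* Multiplicative ℕ :=
  liftSemi (fun _ => Multiplicative.ofAdd 1) (fun _ => 1) (by simp)

/-- The number of red letters of an element. -/
def redDeg : Semi θ →* Multiplicative ℕ :=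
  liftSemi (fun _ => 1) (fun _ => Multiplicative.ofAdd 1) (by simp)

/-- The degree of an element: its numbers of blue and of red letters. -/
def deg (w : Semi θ) : ℕ × ℕ := ((blueDeg w).toAdd, (redDeg w).toAdd)

@[simp] theorem deg_one : deg (1 : Semi θ) = 0 := by simp [deg]
@[simp] theorem deg_mul (w w' : Semi θ) : deg (w * w') = deg w + deg w' := by simp [deg]
@[simp] theorem deg_e (i : Fin m) : deg (e θ i) = (1, 0) := rfl
@[simp] theorem deg_f (j : Fin n) : deg (f θ j) = (0, 1) := rfl
@[simp] theorem deg_pow (w : Semi θ) (N : ℕ) : deg (w ^ N) = N • deg w := by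
  induction N with
  | zero => simp
  | succ N ih => rw [pow_succ, deg_mul, ih, succ_nsmul]

@[simp] theorem deg_eWord (u : List (Fin m)) : deg (eWord θ u) = (u.length, 0) := by
  induction u with
  | nil => exact deg_one
  | cons i u ih => simp [ih, add_comm]

@[simp] theorem deg_fWord (v : List (Fin n)) : deg (fWord θ v) = (0, v.length) := by
  induction v with
  | nil => exact deg_one
  | cons i u ih => simp [ih, add_comm]

theorem exists_eq_e_mul {w : Semi θ} (h : (deg w).1 ≠ 0) : ∃ i r, w = e θ i * r := by
  obtain ⟨u, v, rfl⟩ := exists_eq_eWord_mul_fWord w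
  rcases u with - | ⟨i, u⟩
  · simp at h
  · exact ⟨i, eWord θ u * fWord θ v, by simp [mul_assoc]⟩

theorem exists_eq_f_mul {w : Semi θ} (h : (deg w).2 ≠ 0) : ∃ j r, w = f θ j * r := by
  obtain ⟨u, v, rfl⟩ := exists_eq_eWord_mul_fWord w
  obtain ⟨u', v', -, hv, h'⟩ := eWord_mul_fWord (θ := θ) u v
  rw [h'] at h ⊢
  rcases v' with - | ⟨j, v'⟩
  · simp at h
  · exact ⟨j, fWord θ v' * eWord θ u', by simp [mul_assoc]⟩

/-- Pushing a red letter through a blue word: `f_j e_u = e_{u'} f_{j'}` for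
`(u', j') = pushRed θ j u`. -/
def pushRed (θ : Equiv.Perm (Fin m × Fin n)) : Fin n → List (Fin m) → List (Fin m) × Fin n
  | j, [] => ([], j)
  | j, i :: u => ((θ.symm (i, j)).1 :: (pushRed θ (θ.symm (i, j)).2 u).1,
      (pushRed θ (θ.symm (i, j)).2 u).2)

theorem pushRed_injective {j j' : Fin n} {u u' : List (Fin m)}
    (h : pushRed θ j u = pushRed θ j' u') : j = j' ∧ u = u' := by
  induction u generalizing j j' u' with
  | nil =>
    rcases u' with - | ⟨i', u'⟩
    · simpa [pushRed] using h
    · simp [pushRed] at h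
  | cons i u ih =>
    rcases u' with - | ⟨i', u'⟩
    · simp [pushRed] at h
    · simp only [pushRed, Prod.mk.injEq, List.cons.injEq] at h
      obtain ⟨⟨h1, h2⟩, h3⟩ := h
      obtain ⟨h4, h5⟩ := ih (Prod.ext h2 h3)
      have := θ.symm.injective (Prod.ext h1 h4)
      simp_all

/-- The left regular action of `𝔽_θ⁺`, written on the normal forms `(u, v)` of `e_u f_v`. It
separates the normal forms, which is what makes the letters left cancellable. -/
def nfAct (θ : Equiv.Perm (Fin m × Fin n)) :
    Semi θ →* Function.End (List (Fin m) × List (Fin n)) :=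
  liftSemi (fun i p => (i :: p.1, p.2))
    (fun j p => ((pushRed θ j p.1).1, (pushRed θ j p.1).2 :: p.2)) (by
      intro i j
      funext p
      change ((i :: (pushRed θ j p.1).1, (pushRed θ j p.1).2 :: p.2) :
        List (Fin m) × List (Fin n)) =
        ((pushRed θ (θ (i, j)).2 ((θ (i, j)).1 :: p.1)).1,
          (pushRed θ (θ (i, j)).2 ((θ (i, j)).1 :: p.1)).2 :: p.2)
      simp [pushRed])

theorem nfAct_e_mul (i : Fin m) (w : Semi θ) (p : List (Fin m) × List (Fin n)) :
    nfAct θ (e θ i * w) p = (i :: (nfAct θ w p).1, (nfAct θ w p).2) := by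
  rw [map_mul]; rfl

theorem nfAct_f_mul (j : Fin n) (w : Semi θ) (p : List (Fin m) × List (Fin n)) :
    nfAct θ (f θ j * w) p = ((pushRed θ j (nfAct θ w p).1).1,
      (pushRed θ j (nfAct θ w p).1).2 :: (nfAct θ w p).2) := by
  rw [map_mul]; rfl

theorem nfAct_normalForm (u : List (Fin m)) (v : List (Fin n)) :
    nfAct θ (eWord θ u * fWord θ v) ([], []) = (u, v) := by
  induction u with
  | nil =>
    rw [eWord_nil, one_mul]
    induction v with
    | nil => rw [fWord_nil, map_one]; rfl
    | cons j v ih => rw [fWord_cons, nfAct_f_mul, ih]; rfl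
  | cons i u ih => rw [eWord_cons, mul_assoc, nfAct_e_mul, ih]

theorem nfAct_injective {w w' : Semi θ} (h : nfAct θ w ([], []) = nfAct θ w' ([], [])) :
    w = w' := by
  obtain ⟨u, v, rfl⟩ := exists_eq_eWord_mul_fWord w
  obtain ⟨u', v', rfl⟩ := exists_eq_eWord_mul_fWord w'
  rw [nfAct_normalForm, nfAct_normalForm] at h
  obtain ⟨rfl, rfl⟩ := Prod.ext_iff.1 h
  rfl

theorem e_mul_cancel {i i' : Fin m} {w w' : Semi θ} (h : e θ i * w = e θ i' * w') :
    i = i' ∧ w = w' := by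
  have := congrArg (fun w => nfAct θ w ([], [])) h
  simp only [nfAct_e_mul, Prod.mk.injEq, List.cons.injEq] at this
  exact ⟨this.1.1, nfAct_injective (Prod.ext this.1.2 this.2)⟩

theorem f_mul_cancel {j j' : Fin n} {w w' : Semi θ} (h : f θ j * w = f θ j' * w') :
    j = j' ∧ w = w' := by
  have := congrArg (fun w => nfAct θ w ([], [])) h
  simp only [nfAct_f_mul, Prod.mk.injEq, List.cons.injEq] at this
  obtain ⟨h1, h2⟩ := pushRed_injective (Prod.ext this.1 this.2.1)
  exact ⟨h1, nfAct_injective (Prod.ext h2 this.2.2)⟩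

end Semigroup

/-! ### Actions in which every vertex has one incoming edge of each colour -/

section Actions

variable {m n : ℕ} {θ : Equiv.Perm (Fin m × Fin n)} {ι : Type*}

/-- An action of `𝔽_θ⁺` on a set of vertices in which every vertex is the head of exactly one blue
edge and of exactly one red edge. This is what a defect free atomic representation leaves on the
lines spanned by its basis vectors. -/
structure IsCover (act : Semi θ →* Function.End ι) : Prop where
  blue : Function.Bijective fun p : Fin m × ι => act (e θ p.1) p.2
  red : Function.Bijective fun p : Fin n × ι => act (f θ p.1) p.2

theorem act_mul (act : Semi θ →* Function.End ι) (w w' : Semi θ) (x : ι) :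
    act (w * w') x = act w (act w' x) := by
  rw [map_mul]; rfl

@[simp] theorem act_one (act : Semi θ →* Function.End ι) (x : ι) : act 1 x = x := by
  rw [map_one]; rfl

namespace IsCover

variable {act : Semi θ →* Function.End ι} (h : IsCover act)

/-- The tail of the blue edge that ends at `y`. -/
def blueTail (y : ι) : ι := ((Equiv.ofBijective _ h.blue).symm y).2

/-- The label of the blue edge that ends at `y`. -/
def blueLabel (y : ι) : Fin m := ((Equiv.ofBijective _ h.blue).symm y).1

/-- The tail of the red edge that ends at `y`. -/
def redTail (y : ι) : ι := ((Equiv.ofBijective _ h.red).symm y).2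

/-- The label of the red edge that ends at `y`. -/
def redLabel (y : ι) : Fin n := ((Equiv.ofBijective _ h.red).symm y).1

theorem act_blueLabel (y : ι) : act (e θ (h.blueLabel y)) (h.blueTail y) = y :=
  (Equiv.ofBijective _ h.blue).apply_symm_apply y

theorem act_redLabel (y : ι) : act (f θ (h.redLabel y)) (h.redTail y) = y :=
  (Equiv.ofBijective _ h.red).apply_symm_apply y

@[simp] theorem blueTail_act (i : Fin m) (x : ι) : h.blueTail (act (e θ i) x) = x :=
  congrArg Prod.snd ((Equiv.ofBijective _ h.blue).symm_apply_apply (i, x))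

@[simp] theorem redTail_act (j : Fin n) (x : ι) : h.redTail (act (f θ j) x) = x :=
  congrArg Prod.snd ((Equiv.ofBijective _ h.red).symm_apply_apply (j, x))

theorem blueTail_redTail (y : ι) : h.blueTail (h.redTail y) = h.redTail (h.blueTail y) := by
  obtain ⟨i, x, rfl⟩ : ∃ i x, act (e θ i) x = y := ⟨_, _, h.act_blueLabel y⟩
  obtain ⟨j, x, rfl⟩ : ∃ j z, act (f θ j) z = x := ⟨_, _, h.act_redLabel x⟩
  rw [h.blueTail_act, h.redTail_act, ← act_mul, e_mul_f, act_mul, h.redTail_act, h.blueTail_act]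

/-- Pulling back `d.2` steps along the red edges and `d.1` steps along the blue edges. -/
def back (d : ℕ × ℕ) (y : ι) : ι := h.blueTail^[d.1] (h.redTail^[d.2] y)

@[simp] theorem back_zero (y : ι) : h.back 0 y = y := rfl

theorem back_add (d d' : ℕ × ℕ) (y : ι) : h.back (d + d') y = h.back d (h.back d' y) := by
  have hc : Function.Commute h.blueTail h.redTail := h.blueTail_redTail
  simp only [back, Prod.fst_add, Prod.snd_add, Function.iterate_add_apply]
  rw [(hc.iterate_iterate d'.1 d.2).eq]

theorem back_comm (d d' : ℕ × ℕ) (y : ι) : h.back d (h.back d' y) = h.back d' (h.back d y) := by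
  rw [← back_add, add_comm, back_add]

theorem back_succ_left (a c : ℕ) (y : ι) :
    h.back (a + 1, c) y = h.blueTail (h.back (a, c) y) :=
  Function.iterate_succ_apply' _ _ _

theorem back_succ_right (a c : ℕ) (y : ι) :
    h.back (a, c + 1) y = h.redTail (h.back (a, c) y) := by
  have : ((a, c + 1) : ℕ × ℕ) = (0, 1) + (a, c) := by ext <;> simp [add_comm]
  rw [this, back_add]
  rfl

theorem back_deg (w : Semi θ) (x : ι) : h.back (deg w) (act w x) = x := by
  induction w using semi_induction with
  | one => simp
  | he i w ih =>
    rw [act_mul, deg_mul, add_comm, back_add]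
    simpa [back] using ih
  | hf j w ih =>
    rw [act_mul, deg_mul, add_comm, back_add]
    simpa [back] using ih

theorem exists_act_back (d : ℕ × ℕ) (y : ι) : ∃ w, deg w = d ∧ act w (h.back d y) = y := by
  obtain ⟨a, c⟩ := d
  have hB : ∀ (a : ℕ) (y : ι), ∃ w, deg w = (a, 0) ∧ act w (h.back (a, 0) y) = y := by
    intro a
    induction a with
    | zero => exact fun y => ⟨1, deg_one, by rw [act_one]; rfl⟩
    | succ a ih =>
      intro y
      obtain ⟨w, hw, hy⟩ := ih (h.blueTail y)
      refine ⟨e θ (h.blueLabel y) * w, by simp [hw, add_comm], ?_⟩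
      rw [act_mul]
      exact (congrArg (act (e θ (h.blueLabel y))) hy).trans (h.act_blueLabel y)
  have hR : ∀ (c : ℕ) (y : ι), ∃ w, deg w = (0, c) ∧ act w (h.back (0, c) y) = y := by
    intro c
    induction c with
    | zero => exact fun y => ⟨1, deg_one, by rw [act_one]; rfl⟩
    | succ c ih =>
      intro y
      obtain ⟨w, hw, hy⟩ := ih (h.redTail y)
      refine ⟨f θ (h.redLabel y) * w, by simp [hw, add_comm], ?_⟩
      rw [act_mul]
      exact (congrArg (act (f θ (h.redLabel y))) hy).trans (h.act_redLabel y)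
  obtain ⟨w, hw, hy⟩ := hR c y
  obtain ⟨w', hw', hy'⟩ := hB a (h.back (0, c) y)
  exact ⟨w * w', by simp [hw, hw'], by
    rw [act_mul]
    change act w (act w' (h.back (a, 0) (h.back (0, c) y))) = y
    rw [hy', hy]⟩

theorem eWord_inj (h : IsCover act) {u u' : List (Fin m)} {x x' : ι} (hl : u.length = u'.length)
    (hx : act (eWord θ u) x = act (eWord θ u') x') : u = u' ∧ x = x' := by
  induction u generalizing u' with
  | nil =>
    obtain rfl := List.length_eq_zero_iff.1 hl.symm
    simpa using hx
  | cons i u ih =>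
    rcases u' with - | ⟨i', u'⟩
    · simp at hl
    · simp only [eWord_cons, act_mul] at hx
      have := h.blue.1 (a₁ := (i, _)) (a₂ := (i', _)) hx
      obtain ⟨rfl, h2⟩ := Prod.ext_iff.1 this
      obtain ⟨rfl, rfl⟩ := ih (by simpa using hl) h2
      simp

theorem fWord_inj (h : IsCover act) {v v' : List (Fin n)} {x x' : ι} (hl : v.length = v'.length)
    (hx : act (fWord θ v) x = act (fWord θ v') x') : v = v' ∧ x = x' := by
  induction v generalizing v' with
  | nil =>
    obtain rfl := List.length_eq_zero_iff.1 hl.symm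
    simpa using hx
  | cons i u ih =>
    rcases v' with - | ⟨i', u'⟩
    · simp at hl
    · simp only [fWord_cons, act_mul] at hx
      have := h.red.1 (a₁ := (i, _)) (a₂ := (i', _)) hx
      obtain ⟨rfl, h2⟩ := Prod.ext_iff.1 this
      obtain ⟨rfl, rfl⟩ := ih (by simpa using hl) h2
      simp

/-- For each degree, a vertex is reached by at
most one element, from at most one vertex. -/
theorem act_inj (h : IsCover act) {w w' : Semi θ} {x x' : ι} (hd : deg w = deg w')
    (hx : act w x = act w' x') : w = w' ∧ x = x' := by
  obtain ⟨u, v, rfl⟩ := exists_eq_eWord_mul_fWord w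
  obtain ⟨u', v', rfl⟩ := exists_eq_eWord_mul_fWord w'
  simp only [deg_mul, deg_eWord, deg_fWord, Prod.mk_add_mk, add_zero, zero_add,
    Prod.mk.injEq] at hd
  simp only [act_mul] at hx
  obtain ⟨rfl, hx'⟩ := h.eWord_inj hd.1 hx
  obtain ⟨rfl, rfl⟩ := h.fWord_inj hd.2 hx'
  simp

/-- Two vertices of the same blue component have a common vertex below them. -/
theorem exists_back_eq_of_eqvGen {x y : ι}
    (hxy : Relation.EqvGen (fun x y => ∃ i, act (e θ i) x = y) x y) :
    ∃ a a' : ℕ, h.back (a, 0) x = h.back (a', 0) y := by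
  induction hxy with
  | rel x y hxy =>
    obtain ⟨i, rfl⟩ := hxy
    exact ⟨0, 1, by simp [back]⟩
  | refl x => exact ⟨0, 0, rfl⟩
  | symm x y _ ih => exact ⟨ih.choose_spec.choose, ih.choose, ih.choose_spec.choose_spec.symm⟩
  | trans x y z _ _ ih ih' =>
    obtain ⟨a, a', h1⟩ := ih
    obtain ⟨c, c', h2⟩ := ih'
    refine ⟨c + a, a' + c', ?_⟩
    have e1 : ((c + a, 0) : ℕ × ℕ) = (c, 0) + (a, 0) := rfl
    have e2 : ((a' + c', 0) : ℕ × ℕ) = (a', 0) + (c', 0) := rfl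
    rw [e1, e2, back_add, back_add, h1, back_comm, h2]

theorem eqvGen_back (a : ℕ) (x : ι) :
    Relation.EqvGen (fun x y => ∃ i, act (e θ i) x = y) (h.back (a, 0) x) x := by
  induction a generalizing x with
  | zero => exact .refl x
  | succ a ih => exact .trans _ _ _ (ih (h.blueTail x)) (.rel _ _ ⟨_, h.act_blueLabel x⟩)

theorem eqvGen_of_back_eq {x y : ι} {a a' : ℕ} (hxy : h.back (a, 0) x = h.back (a', 0) y) :
    Relation.EqvGen (fun x y => ∃ i, act (e θ i) x = y) x y :=
  .trans _ _ _ (.symm _ _ (h.eqvGen_back a x)) (hxy ▸ h.eqvGen_back a' y)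

/-- A vertex of a representation of type 3bi at which data can be read off: pulling back `k` blue
and `l` red steps returns to `x`, the blue components below `x` repeat after exactly `l` red steps,
and blue components are infinite tails. -/
structure IsRecurrent (k l : ℕ) (x : ι) : Prop where
  blue_pos : 0 < k
  red_pos : 0 < l
  loop : h.back (k, l) x = x
  tail : ∀ y, Function.Injective fun a : ℕ => h.back (a, 0) y
  least : ∀ r, 0 < r → r < l → ∀ a a' : ℕ, h.back (a, r) x ≠ h.back (a', 0) x

namespace IsRecurrent

variable {h} {k l : ℕ} {x : ι}

theorem back_nsmul (hx : h.IsRecurrent k l x) (N : ℕ) : h.back (N • (k, l)) x = x := by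
  induction N with
  | zero => simp
  | succ N ih => rw [succ_nsmul, back_add, hx.loop, ih]

theorem eq_nsmul_of_back_eq_self (hx : h.IsRecurrent k l x) {d : ℕ × ℕ} (hd : h.back d x = x) :
    ∃ q : ℕ, d = q • (k, l) := by
  obtain ⟨a, c⟩ := d
  have hmod : c = c % l + c / l * l := (Nat.mod_add_div' c l).symm
  set q := c / l
  set r := c % l
  -- running `q` times through the loop at `x` removes the multiple of `l` from `c`
  have key : h.back (a, r) x = h.back (q * k, 0) x := by
    conv_rhs => rw [← hd]
    rw [← back_add]
    have : ((q * k, 0) : ℕ × ℕ) + (a, c) = (a, r) + q • (k, l) := by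
      ext
      · simp [add_comm]
      · simp [hmod]
    rw [this, back_add, hx.back_nsmul]
  have hr : r = 0 := by
    by_contra hr
    exact hx.least r (Nat.pos_of_ne_zero hr) (Nat.mod_lt _ hx.red_pos) _ _ key
  rw [hr] at key
  refine ⟨q, ?_⟩
  have := hx.tail x key
  ext
  · simpa using this
  · simp [hmod, hr]

/-- Two pullbacks of a recurrent vertex agree exactly if their degrees agree modulo `(k, l)`. -/
theorem back_eq_iff (hx : h.IsRecurrent k l x) {d d' : ℕ × ℕ} :
    h.back d x = h.back d' x ↔ ∃ N M : ℕ, d + N • (k, l) = d' + M • (k, l) := by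
  constructor
  · intro hd
    -- extend `d` to a multiple of `(k, l)`
    obtain ⟨c, hc⟩ : ∃ c, c + d = (d.1 + d.2) • (k, l) := by
      refine ⟨(d.1 + d.2) • (k, l) - d, tsub_add_cancel_of_le ?_⟩
      constructor
      · simp only [Prod.smul_fst, smul_eq_mul]
        nlinarith [hx.blue_pos]
      · simp only [Prod.smul_snd, smul_eq_mul]
        nlinarith [hx.red_pos]
    have h1 : h.back (c + d') x = x := by
      rw [back_add, ← hd, ← back_add, hc, hx.back_nsmul]
    obtain ⟨q, hq⟩ := hx.eq_nsmul_of_back_eq_self h1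
    refine ⟨q, d.1 + d.2, ?_⟩
    rw [← hq, ← hc]
    abel
  · rintro ⟨N, M, hNM⟩
    have := congrArg (fun d => h.back d x) hNM
    simpa only [back_add, hx.back_nsmul] using this

/-- The vertices reached from a recurrent vertex: `w` and `w'` lead to the same vertex exactly if
they become equal after finitely many turns around the loop `z`. The right hand side does not
mention the action, so the data determine the action. -/
theorem act_eq_iff (hx : h.IsRecurrent k l x) {z : Semi θ}
    (hz : act z x = x) (hdz : deg z = (k, l)) {w w' : Semi θ} :
    act w x = act w' x ↔ ∃ N M : ℕ, w * z ^ N = w' * z ^ M := by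
  have hpow : ∀ N : ℕ, act (z ^ N) x = x := by
    intro N
    induction N with
    | zero => simp
    | succ N ih => rw [pow_succ, act_mul, hz, ih]
  constructor
  · intro hw
    have h1 : h.back (deg w') x = h.back (deg w) x := by
      conv_lhs => rw [← h.back_deg w x, hw, back_comm, back_deg]
    obtain ⟨M, N, hNM⟩ := hx.back_eq_iff.1 h1
    refine ⟨N, M, (h.act_inj (x := x) (x' := x) ?_ ?_).1⟩
    · rw [deg_mul, deg_mul, deg_pow, deg_pow, hdz, hNM]
    · rw [act_mul, act_mul, hpow, hpow, hw]
  · rintro ⟨N, M, hNM⟩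
    have := congrArg (fun w => act w x) hNM
    simpa [act_mul, hpow] using this

/-- In a connected graph every vertex lies above every recurrent vertex. -/
theorem exists_act_eq (hx : h.IsRecurrent k l x) {z : Semi θ}
    (hz : act z x = x) (hdz : deg z = (k, l)) {y : ι}
    (hc : Relation.EqvGen
      (fun x y => (∃ i, act (e θ i) x = y) ∨ ∃ j, act (f θ j) x = y) x y) :
    ∃ w, act w x = y := by
  have step : ∀ x' y', ((∃ i, act (e θ i) x' = y') ∨ ∃ j, act (f θ j) x' = y') →
      ((∃ w, act w x = x') ↔ ∃ w, act w x = y') := by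
    rintro x' y' hxy
    constructor
    · rintro ⟨w, rfl⟩
      obtain ⟨i, rfl⟩ | ⟨j, rfl⟩ := hxy
      · exact ⟨e θ i * w, act_mul _ _ _ _⟩
      · exact ⟨f θ j * w, act_mul _ _ _ _⟩
    · rintro ⟨w, rfl⟩
      -- one turn around the loop makes sure that the word has letters of both colours
      have hwz : act (w * z) x = act w x := by rw [act_mul, hz]
      obtain ⟨i, hi⟩ | ⟨j, hj⟩ := hxy
      · obtain ⟨i', r, hr⟩ := exists_eq_e_mul (w := w * z)
          (by simp [hdz, hx.blue_pos.ne'])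
        refine ⟨r, ?_⟩
        rw [← h.blueTail_act i' (act r x), ← act_mul, ← hr, hwz, ← hi, h.blueTail_act]
      · obtain ⟨j', r, hr⟩ := exists_eq_f_mul (w := w * z)
          (by simp [hdz, hx.red_pos.ne'])
        refine ⟨r, ?_⟩
        rw [← h.redTail_act j' (act r x), ← act_mul, ← hr, hwz, ← hj, h.redTail_act]
  have hiff : ∀ x' y', Relation.EqvGen
      (fun x y => (∃ i, act (e θ i) x = y) ∨ ∃ j, act (f θ j) x = y) x' y' →
      ((∃ w, act w x = x') ↔ ∃ w, act w x = y') := by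
    intro x' y' hxy
    induction hxy with
    | rel x' y' hxy => exact step _ _ hxy
    | refl => exact Iff.rfl
    | symm _ _ _ ih => exact ih.symm
    | trans _ _ _ _ _ ih ih' => exact ih.trans ih'
  exact (hiff x y hc).1 ⟨1, act_one _ _⟩

/-- Vertices below a recurrent vertex along blue edges are recurrent. -/
theorem blueTail (hx : h.IsRecurrent k l x) : h.IsRecurrent k l (h.blueTail x) where
  blue_pos := hx.blue_pos
  red_pos := hx.red_pos
  loop := by
    change h.back (k, l) (h.back (1, 0) x) = h.back (1, 0) x
    rw [back_comm, hx.loop]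
  tail := hx.tail
  least := by
    intro r hr hrl a a' heq
    refine hx.least r hr hrl (a + 1) (a' + 1) ?_
    change h.back ((a, r) + (1, 0)) x = h.back ((a', 0) + (1, 0)) x
    rw [back_add, back_add]
    exact heq

end IsRecurrent

end IsCover

end Actions

/-! ### The action on the lines spanned by the basis vectors -/

section Rep

variable {m n : ℕ} {θ : Equiv.Perm (Fin m × Fin n)} {ι H : Type*}
  [NormedAddCommGroup H] [InnerProductSpace ℂ H]
  {π : Semi θ →* (H →L[ℂ] H)} {b : HilbertBasis ι ℂ H}

theorem basis_inner_self (b : HilbertBasis ι ℂ H) (x : ι) : inner ℂ (b x) (b x) = 1 := by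
  rw [inner_self_eq_norm_sq_to_K, b.orthonormal.1 x]; simp

theorem basis_norm (b : HilbertBasis ι ℂ H) (x : ι) : ‖b x‖ = 1 := b.orthonormal.1 x

theorem basis_inner_ne (b : HilbertBasis ι ℂ H) {x y : ι} (hxy : x ≠ y) :
    inner ℂ (b x) (b y) = 0 := b.orthonormal.2 hxy

theorem basis_eq_of_smul_eq (b : HilbertBasis ι ℂ H) {x y : ι} {c d : ℂ} (hc : c ≠ 0)
    (hcd : c • b x = d • b y) : x = y := by
  by_contra hxy
  have := congrArg (fun v => inner ℂ (b x) v) hcd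
  simp only [inner_smul_right, basis_inner_self, basis_inner_ne b hxy, mul_one, mul_zero] at this
  exact hc this

theorem Carries.unique {w : Semi θ} {x y y' : ι} (h : Carries π b w x y)
    (h' : Carries π b w x y') : y = y' := by
  obtain ⟨c, hc, h⟩ := h
  obtain ⟨c', hc', h'⟩ := h'
  exact basis_eq_of_smul_eq b hc (h.symm.trans h')

theorem Carries.mul {w w' : Semi θ} {x y z : ι} (h : Carries π b w y z)
    (h' : Carries π b w' x y) : Carries π b (w * w') x z := by
  obtain ⟨c, hc, h⟩ := h
  obtain ⟨c', hc', h'⟩ := h'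
  exact ⟨c' * c, mul_ne_zero hc' hc, by
    rw [map_mul, ← smul_smul, ← h, ← map_smul, ← h']; rfl⟩

theorem continuousLinearMap_ext_basis {H' : Type*} [NormedAddCommGroup H']
    [InnerProductSpace ℂ H'] (b : HilbertBasis ι ℂ H) {S T : H →L[ℂ] H'}
    (h : ∀ x, S (b x) = T (b x)) : S = T := by
  refine ContinuousLinearMap.ext_on (s := Set.range b) ?_ ?_
  · exact Submodule.dense_iff_topologicalClosure_eq_top.2 b.dense_span
  · rintro _ ⟨x, rfl⟩
    exact h x

theorem eq_zero_of_inner_basis (b : HilbertBasis ι ℂ H) {v : H}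
    (h : ∀ x, inner ℂ (b x) v = 0) : v = 0 := by
  apply b.repr.injective
  ext x
  simp [b.repr_apply_apply, h]

variable [CompleteSpace H]

namespace IsStarRep

theorem norm_apply (hs : IsStarRep π) (w : Semi θ) (η : H) : ‖π w η‖ = ‖η‖ :=
  (AddMonoidHomClass.isometry_iff_norm (π w)).1 (hs.isometry w) η

theorem exists_carries (hs : IsStarRep π) (ha : IsAtomic π b) (w : Semi θ) (x : ι) :
    ∃ y, Carries π b w x y := by
  obtain ⟨y, c, -, h⟩ := ha w x
  refine ⟨y, c, ?_, h⟩
  rintro rfl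
  have := hs.norm_apply w (b x)
  rw [h, zero_smul, norm_zero, basis_norm] at this
  exact zero_ne_one this

/-- The vertex to which `w` carries the vertex `x`. -/
def next (hs : IsStarRep π) (ha : IsAtomic π b) (w : Semi θ) (x : ι) : ι :=
  (hs.exists_carries ha w x).choose

theorem carries_next (hs : IsStarRep π) (ha : IsAtomic π b) (w : Semi θ) (x : ι) :
    Carries π b w x (hs.next ha w x) :=
  (hs.exists_carries ha w x).choose_spec

/-- The action of `𝔽_θ⁺` on the vertices of the graph of an atomic representation. -/
def act (hs : IsStarRep π) (ha : IsAtomic π b) : Semi θ →* Function.End ι where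
  toFun w := hs.next ha w
  map_one' := by
    funext x
    exact (hs.carries_next ha 1 x).unique ⟨1, one_ne_zero, by rw [map_one, one_smul]; rfl⟩
  map_mul' w w' := by
    funext x
    exact (hs.carries_next ha (w * w') x).unique
      ((hs.carries_next ha w _).mul (hs.carries_next ha w' x))

theorem carries_iff (hs : IsStarRep π) (ha : IsAtomic π b) {w : Semi θ} {x y : ι} :
    Carries π b w x y ↔ hs.act ha w x = y :=
  ⟨fun h => (hs.carries_next ha w x).unique h, by
    rintro rfl; exact hs.carries_next ha w x⟩

theorem carries_act (hs : IsStarRep π) (ha : IsAtomic π b) (w : Semi θ) (x : ι) :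
    Carries π b w x (hs.act ha w x) := hs.carries_next ha w x

/-- For isometries of defect zero that permute the basis up to scalars, every basis vector lies in
the range of exactly one of them. -/
theorem bijective_of_defect {N : ℕ} {A : Fin N → H →L[ℂ] H} {σ : Fin N → ι → ι}
    (b : HilbertBasis ι ℂ H)
    (hA : ∀ i η, ‖A i η‖ = ‖η‖) (hd : ∑ i, A i ∘L ContinuousLinearMap.adjoint (A i) = 1)
    (hσ : ∀ i x, ∃ c : ℂ, c ≠ 0 ∧ A i (b x) = c • b (σ i x)) :
    Function.Bijective fun p : Fin N × ι => σ p.1 p.2 := by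
  have hAA : ∀ i η, ContinuousLinearMap.adjoint (A i) (A i η) = η := fun i η =>
    congrArg (fun T => T η) ((ContinuousLinearMap.norm_map_iff_adjoint_comp_self (A i)).1 (hA i))
  have hdef : ∀ η, ∑ i, A i (ContinuousLinearMap.adjoint (A i) η) = η := by
    intro η
    have := congrArg (fun T => T η) hd
    simpa [sum_apply] using this
  -- the adjoint has norm one on the basis vectors which are hit
  have hone : ∀ i x, ‖ContinuousLinearMap.adjoint (A i) (b (σ i x))‖ = 1 := by
    intro i x
    obtain ⟨c, hc, h⟩ := hσ i x
    have h1 : ‖c‖ = 1 := by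
      have := hA i (b x)
      rwa [h, norm_smul, basis_norm, basis_norm, mul_one] at this
    have h2 := hAA i (b x)
    rw [h, map_smul] at h2
    have := congrArg norm h2
    rwa [norm_smul, h1, one_mul, basis_norm] at this
  have hsum : ∀ y, ∑ i, ‖ContinuousLinearMap.adjoint (A i) (b y)‖ ^ 2 = 1 := by
    intro y
    have h1 := congrArg (fun v => inner ℂ (b y) v) (hdef (b y))
    simp only [inner_sum, basis_inner_self] at h1
    have h2 : ∀ i, inner ℂ (b y) (A i (ContinuousLinearMap.adjoint (A i) (b y)))
        = ((‖ContinuousLinearMap.adjoint (A i) (b y)‖ ^ 2 : ℝ) : ℂ) := by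
      intro i
      rw [← ContinuousLinearMap.adjoint_inner_left, inner_self_eq_norm_sq_to_K]
      push_cast; rfl
    simp only [h2] at h1
    exact_mod_cast h1
  constructor
  · rintro ⟨i, x⟩ ⟨i', x'⟩ hxx
    change σ i x = σ i' x' at hxx
    have hi : i = i' := by
      by_contra hne
      have h1 : ∑ j ∈ {i, i'}, ‖ContinuousLinearMap.adjoint (A j) (b (σ i x))‖ ^ 2 ≤ 1 := by
        rw [← hsum (σ i x)]
        exact Finset.sum_le_sum_of_subset_of_nonneg (Finset.subset_univ _)
          fun _ _ _ => by positivity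
      rw [Finset.sum_pair hne, hone, hxx, hone] at h1
      norm_num at h1
    subst hi
    obtain ⟨c, hc, h⟩ := hσ i x
    obtain ⟨c', hc', h'⟩ := hσ i x'
    have : c' • b x = c • b x' := by
      rw [← hAA i (c' • b x), ← hAA i (c • b x'), map_smul (A i), map_smul (A i), h, h', hxx,
        smul_comm]
    rw [basis_eq_of_smul_eq b hc' this]
  · intro y
    obtain ⟨i, hi⟩ : ∃ i, ContinuousLinearMap.adjoint (A i) (b y) ≠ 0 := by
      by_contra! hall
      have := hsum y
      simp [hall] at this
    obtain ⟨x, hx⟩ : ∃ x, inner ℂ (b x) (ContinuousLinearMap.adjoint (A i) (b y)) ≠ 0 := by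
      by_contra! hall
      exact hi (eq_zero_of_inner_basis b hall)
    refine ⟨(i, x), ?_⟩
    by_contra hne
    obtain ⟨c, hc, h⟩ := hσ i x
    rw [ContinuousLinearMap.adjoint_inner_right, h, inner_smul_left, basis_inner_ne b hne,
      mul_zero] at hx
    exact hx rfl

theorem isCover (hs : IsStarRep π) (ha : IsAtomic π b) : IsCover (hs.act ha) where
  blue := bijective_of_defect (A := fun i => π (e θ i)) b (fun _ => hs.norm_apply _) hs.defect_e
    fun i x => hs.carries_act ha (e θ i) x
  red := bijective_of_defect (A := fun j => π (f θ j)) b (fun _ => hs.norm_apply _) hs.defect_f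
    fun i x => hs.carries_act ha (f θ i) x

end IsStarRep

/-! ### Data at a vertex -/

theorem sameBlue_iff (hs : IsStarRep π) (ha : IsAtomic π b) {x y : ι} :
    SameBlue π b x y ↔ Relation.EqvGen (fun x y => ∃ i, hs.act ha (e θ i) x = y) x y := by
  unfold SameBlue BlueEdge
  simp only [hs.carries_iff ha]

theorem redReturns_iff (hs : IsStarRep π) (ha : IsAtomic π b) {x : ι} {l : ℕ} :
    RedReturns π b x l ↔
      0 < l ∧ ∃ a a' : ℕ, (hs.isCover ha).back (a, l) x = (hs.isCover ha).back (a', 0) x := by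
  set h := hs.isCover ha
  constructor
  · rintro ⟨hl, y, v, hv, hvy, hyx⟩
    obtain ⟨a, a', haa⟩ := h.exists_back_eq_of_eqvGen ((sameBlue_iff hs ha).1 hyx)
    refine ⟨hl, a, a', ?_⟩
    have h1 := h.back_deg (fWord θ v) y
    rw [(hs.carries_iff ha).1 hvy, deg_fWord, hv] at h1
    rw [← haa, ← h1, ← h.back_add]
    simp
  · rintro ⟨hl, a, a', haa⟩
    obtain ⟨w, hw, hwx⟩ := h.exists_act_back (0, l) x
    obtain ⟨u, v, rfl⟩ := exists_eq_eWord_mul_fWord w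
    simp only [deg_mul, deg_eWord, deg_fWord, Prod.mk_add_mk, add_zero, zero_add,
      Prod.mk.injEq] at hw
    obtain rfl := List.length_eq_zero_iff.1 hw.1
    refine ⟨hl, h.back (0, l) x, v, hw.2, (hs.carries_iff ha).2 (by simpa using hwx),
      (sameBlue_iff hs ha).2 (h.eqvGen_of_back_eq (a := a) (a' := a') ?_)⟩
    rw [← h.back_add, ← haa]
    simp

theorem IsType3bi.tail (hπ : IsType3bi π b) (y : ι) :
    Function.Injective fun a : ℕ => (hπ.starRep.isCover hπ.atomic).back (a, 0) y := by
  set h := hπ.starRep.isCover hπ.atomic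
  obtain ⟨z, rfl, hinj, hz⟩ := hπ.blue_tail y
  have : (fun a : ℕ => h.back (a, 0) (z 0)) = z := by
    funext a
    induction a with
    | zero => rfl
    | succ a ih =>
      obtain ⟨i, hi⟩ := hz a
      have h1 := (hπ.starRep.carries_iff hπ.atomic).1 hi
      change h.back (a, 0) (z 0) = z a at ih
      change h.back (a + 1, 0) (z 0) = z (a + 1)
      rw [h.back_succ_left, ih, ← h1, h.blueTail_act]
  rw [this]
  exact hinj

theorem HasData.act_eq {u₀ : List (Fin m)} {v₀ : List (Fin n)} {β : Circle} {x : ι}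
    (hs : IsStarRep π) (ha : IsAtomic π b) (hx : HasData π b u₀ v₀ β x) :
    hs.act ha (eWord θ u₀ * fWord θ v₀) x = x :=
  (hs.carries_iff ha).1 ⟨β, Circle.coe_ne_zero β, hx.eigen⟩

theorem hasBluePeriod_iff (hs : IsStarRep π) (ha : IsAtomic π b) {x : ι} {l : ℕ} :
    HasBluePeriod π b x l ↔
      (0 < l ∧ ∃ a a' : ℕ, (hs.isCover ha).back (a, l) x = (hs.isCover ha).back (a', 0) x) ∧
      ∀ r, 0 < r → r < l →
        ∀ a a' : ℕ, (hs.isCover ha).back (a, r) x ≠ (hs.isCover ha).back (a', 0) x := by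
  refine and_congr (redReturns_iff hs ha) ?_
  simp only [mem_lowerBounds, Set.mem_ofPred_eq, redReturns_iff hs ha]
  constructor
  · intro h r hr hrl a a' heq
    exact absurd (h r ⟨hr, a, a', heq⟩) (by omega)
  · rintro h r ⟨hr, a, a', heq⟩
    by_contra hlt
    exact h r hr (by omega) a a' heq

theorem HasData.isRecurrent {u₀ : List (Fin m)} {v₀ : List (Fin n)} {β : Circle} {x : ι}
    (hx : HasData π b u₀ v₀ β x) (hπ : IsType3bi π b) :
    (hπ.starRep.isCover hπ.atomic).IsRecurrent u₀.length v₀.length x where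
  blue_pos := List.length_pos_iff.2 hx.ne_nil
  red_pos := hx.period.1.1
  loop := by
    have := (hπ.starRep.isCover hπ.atomic).back_deg (eWord θ u₀ * fWord θ v₀) x
    rw [hx.act_eq hπ.starRep hπ.atomic] at this
    simpa using this
  tail := hπ.tail
  least := ((hasBluePeriod_iff hπ.starRep hπ.atomic).1 hx.period).2

/-- A loop at `x` of degree `(k, l)`, where `l` is the exact period, gives data at `x`. -/
theorem hasData_of_eigen {x : ι} {z : Semi θ} {k l : ℕ} {β : ℂ}
    (hs : IsStarRep π) (hk : 0 < k) (hdz : deg z = (k, l)) (hp : HasBluePeriod π b x l)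
    (hz : π z (b x) = β • b x) :
    ∃ (u₀ : List (Fin m)) (v₀ : List (Fin n)) (β' : Circle), u₀.length = k ∧ v₀.length = l ∧
      (β' : ℂ) = β ∧ HasData π b u₀ v₀ β' x := by
  obtain ⟨u, v, rfl⟩ := exists_eq_eWord_mul_fWord z
  simp only [deg_mul, deg_eWord, deg_fWord, Prod.mk_add_mk, add_zero, zero_add,
    Prod.mk.injEq] at hdz
  obtain ⟨rfl, rfl⟩ := hdz
  have hβ : ‖β‖ = 1 := by
    have := hs.norm_apply (eWord θ u * fWord θ v) (b x)
    rwa [hz, norm_smul, basis_norm, mul_one] at this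
  exact ⟨u, v, ⟨β, mem_sphere_zero_iff_norm.2 hβ⟩, rfl, rfl, rfl, List.length_pos_iff.1 hk, hp, hz⟩

theorem IsType3bi.exists_hasData (hπ : IsType3bi π b) :
    ∃ (u₀ : List (Fin m)) (v₀ : List (Fin n)) (β : Circle) (x : ι), HasData π b u₀ v₀ β x := by
  obtain ⟨x, y, u, v, hu, hp, hxy, hyx⟩ := hπ.return_below
  obtain ⟨c, -, hc⟩ := hyx.mul hxy
  obtain ⟨u₀, v₀, β, -, -, -, h⟩ := hasData_of_eigen (k := u.length) hπ.starRep
    (List.length_pos_iff.2 hu) (by simp) hp hc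
  exact ⟨u₀, v₀, β, x, h⟩

end Rep

/-! ### The data determine the representation -/

section Uniqueness

variable {m n : ℕ} {θ : Equiv.Perm (Fin m × Fin n)} {ι H ι' H' : Type*}
  [NormedAddCommGroup H] [InnerProductSpace ℂ H]
  [NormedAddCommGroup H'] [InnerProductSpace ℂ H']
  {π : Semi θ →* (H →L[ℂ] H)} {b : HilbertBasis ι ℂ H}
  {π' : Semi θ →* (H' →L[ℂ] H')} {b' : HilbertBasis ι' ℂ H'}
  {u₀ : List (Fin m)} {v₀ : List (Fin n)} {β : Circle} {x : ι} {x' : ι'}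

theorem rep_mul_apply (π : Semi θ →* (H →L[ℂ] H)) (w w' : Semi θ) (η : H) :
    π (w * w') η = π w (π w' η) := by
  rw [map_mul]; rfl

theorem apply_mul_pow {z w : Semi θ} {c : ℂ} {η : H} (hz : π z η = c • η) (N : ℕ) :
    π (w * z ^ N) η = c ^ N • π w η := by
  induction N with
  | zero => simp
  | succ N ih => rw [pow_succ, ← mul_assoc, rep_mul_apply, hz, map_smul, ih, smul_smul, pow_succ']

variable [CompleteSpace H] [CompleteSpace H']

theorem IsType3bi.exists_act_eq (hπ : IsType3bi π b) (hx : HasData π b u₀ v₀ β x) (y : ι) :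
    ∃ w, hπ.starRep.act hπ.atomic w x = y := by
  refine (hx.isRecurrent hπ).exists_act_eq (hx.act_eq hπ.starRep hπ.atomic) (by simp) ?_
  have := hπ.connected.2 x y
  simpa only [BlueEdge, RedEdge, hπ.starRep.carries_iff hπ.atomic] using this

theorem IsType3bi.act_eq_iff (hπ : IsType3bi π b) (hx : HasData π b u₀ v₀ β x)
    {w w' : Semi θ} :
    hπ.starRep.act hπ.atomic w x = hπ.starRep.act hπ.atomic w' x ↔
      ∃ N M : ℕ, w * (eWord θ u₀ * fWord θ v₀) ^ N = w' * (eWord θ u₀ * fWord θ v₀) ^ M :=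
  (hx.isRecurrent hπ).act_eq_iff (hx.act_eq hπ.starRep hπ.atomic) (by simp)

/-- Two representations with the same data are unitarily equivalent: both spaces are spanned by
the orbit of the vector at which the data are read off, and the multiples by which two elements of
the orbit differ depend only on the data. -/
theorem exists_unitary (hπ : IsType3bi π b) (hπ' : IsType3bi π' b')
    (hx : HasData π b u₀ v₀ β x) (hx' : HasData π' b' u₀ v₀ β x') :
    ∃ U : H ≃ₗᵢ[ℂ] H', U (b x) = b' x' ∧ ∀ w η, U (π w η) = π' w (U η) := by
  set act := hπ.starRep.act hπ.atomic
  set act' := hπ'.starRep.act hπ'.atomic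
  have hiff : ∀ w w', act w x = act w' x ↔ act' w x' = act' w' x' := fun w w' =>
    (hπ.act_eq_iff hx).trans (hπ'.act_eq_iff hx').symm
  have hmul : ∀ w w', act w x = act w' x →
      ∃ d : ℂ, π w (b x) = d • π w' (b x) ∧ π' w (b' x') = d • π' w' (b' x') := by
    intro w w' hw
    obtain ⟨N, M, h⟩ := (hπ.act_eq_iff hx).1 hw
    have hβ : (β : ℂ) ^ N ≠ 0 := pow_ne_zero _ (Circle.coe_ne_zero β)
    refine ⟨((β : ℂ) ^ N)⁻¹ * (β : ℂ) ^ M, ?_, ?_⟩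
    · rw [← smul_smul, ← apply_mul_pow hx.eigen, ← h, apply_mul_pow hx.eigen, inv_smul_smul₀ hβ]
    · rw [← smul_smul, ← apply_mul_pow hx'.eigen, ← h, apply_mul_pow hx'.eigen,
        inv_smul_smul₀ hβ]
  choose w hw using hπ.exists_act_eq hx
  have hc : ∀ y, ∃ c : ℂ, c ≠ 0 ∧ π (w y) (b x) = c • b y := fun y =>
    (hπ.starRep.carries_iff hπ.atomic).2 (hw y)
  choose c hc0 hc using hc
  have hc1 : ∀ y, ‖c y‖ = 1 := by
    intro y
    have := hπ.starRep.norm_apply (w y) (b x)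
    rwa [hc, norm_smul, basis_norm, basis_norm, mul_one] at this
  -- the images of the basis vectors under the intertwining operator
  let v : ι → H' := fun y => (c y)⁻¹ • π' (w y) (b' x')
  have hv : Orthonormal ℂ v := by
    constructor
    · intro y
      rw [norm_smul, norm_inv, hc1, hπ'.starRep.norm_apply, basis_norm]
      simp
    · intro y y₂ hy
      obtain ⟨c₁, -, h1⟩ : Carries π' b' (w y) x' (act' (w y) x') :=
        hπ'.starRep.carries_act hπ'.atomic (w y) x'
      obtain ⟨c₂, -, h2⟩ : Carries π' b' (w y₂) x' (act' (w y₂) x') :=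
        hπ'.starRep.carries_act hπ'.atomic (w y₂) x'
      have hne : act' (w y) x' ≠ act' (w y₂) x' := by
        rwa [Ne, ← hiff, hw, hw]
      simp only [v, h1, h2, inner_smul_left, inner_smul_right, basis_inner_ne b' hne, mul_zero]
  have hπv : ∀ w', ∃ d : ℂ, π w' (b x) = d • b (act w' x) ∧
      π' w' (b' x') = d • v (act w' x) := by
    intro w'
    obtain ⟨d, h1, h2⟩ := hmul w' (w (act w' x)) (hw _).symm
    refine ⟨d * c (act w' x), ?_, ?_⟩
    · rw [h1, hc, smul_smul]
    · rw [h2, ← smul_smul, smul_inv_smul₀ (hc0 _)]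
  have hspan : ⊤ ≤ (Submodule.span ℂ (Set.range v)).topologicalClosure := by
    rw [← b'.dense_span]
    refine Submodule.topologicalClosure_mono (Submodule.span_le.2 ?_)
    rintro _ ⟨y', rfl⟩
    obtain ⟨w', hw'⟩ := hπ'.exists_act_eq hx' y'
    obtain ⟨c', hc', h1⟩ := (hπ'.starRep.carries_iff hπ'.atomic).2 hw'
    obtain ⟨d, -, h2⟩ := hπv w'
    have : b' y' = (c'⁻¹ * d) • v (act w' x) := by
      rw [← smul_smul, ← h2, h1, inv_smul_smul₀ hc']
    rw [this]
    exact Submodule.smul_mem _ _ (Submodule.subset_span ⟨_, rfl⟩)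
  let B : HilbertBasis ι ℂ H' := HilbertBasis.mk hv hspan
  let U : H ≃ₗᵢ[ℂ] H' := b.repr.trans B.repr.symm
  have hU : ∀ y, U (b y) = v y := by
    classical
    intro y
    change B.repr.symm (b.repr (b y)) = v y
    rw [b.repr_self, B.repr_symm_single, HilbertBasis.coe_mk]
  have hUπ : ∀ w', U (π w' (b x)) = π' w' (b' x') := by
    intro w'
    obtain ⟨d, h1, h2⟩ := hπv w'
    rw [h1, h2, map_smul, hU]
  have hUx : U (b x) = b' x' := by simpa using hUπ 1
  refine ⟨U, hUx, fun w' η => ?_⟩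
  have hext : (U : H →L[ℂ] H').comp (π w') = (π' w').comp (U : H →L[ℂ] H') := by
    refine continuousLinearMap_ext_basis b fun y => ?_
    change U (π w' (b y)) = π' w' (U (b y))
    have hy : b y = (c y)⁻¹ • π (w y) (b x) := by rw [hc, inv_smul_smul₀ (hc0 y)]
    rw [hy]
    simp only [map_smul]
    rw [hUπ, ← rep_mul_apply, ← rep_mul_apply, hUπ]
  exact congrArg (fun T => T η) hext

end Uniqueness

/-! ### The grid of vertices through a recurrent vertex -/

section Grid

variable {k l : ℕ}

theorem cls_add (s t s' t' : ℤ) : cls k l s t + cls k l s' t' = cls k l (s + s') (t + t') := rfl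

theorem cls_eq_cls_iff {s t s' t' : ℤ} :
    cls k l s t = cls k l s' t' ↔ ∃ q : ℤ, s' = s + q * k ∧ t' = t + q * l := by
  unfold cls
  rw [QuotientAddGroup.eq, AddSubgroup.mem_zmultiples_iff]
  refine exists_congr fun q => ?_
  simp only [Prod.smul_mk, smul_eq_mul, Prod.neg_mk, Prod.mk_add_mk, Prod.mk.injEq]
  constructor <;> rintro ⟨h1, h2⟩ <;> constructor <;> linarith

/-- The class of `-d`. -/
def negCls (k l : ℕ) (d : ℕ × ℕ) : Grp k l := cls k l (-d.1) (-d.2)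

theorem negCls_eq_iff {d d' : ℕ × ℕ} :
    negCls k l d = negCls k l d' ↔ ∃ N M : ℕ, d + N • (k, l) = d' + M • (k, l) := by
  unfold negCls
  rw [cls_eq_cls_iff]
  have key : ∀ N M : ℕ, d + N • (k, l) = d' + M • (k, l) ↔
      (d.1 : ℤ) + N * k = d'.1 + M * k ∧ (d.2 : ℤ) + N * l = d'.2 + M * l := by
    intro N M
    rw [Prod.ext_iff]
    simp only [Prod.fst_add, Prod.snd_add, Prod.smul_fst, Prod.smul_snd, smul_eq_mul]
    norm_cast
  simp only [key]
  constructor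
  · rintro ⟨q, h1, h2⟩
    have hq : q = (q.toNat : ℤ) - ((-q).toNat : ℤ) := by omega
    generalize (q.toNat : ℤ) = a at hq
    refine ⟨(-q).toNat, q.toNat, ?_⟩
    have hq : q = (q.toNat : ℤ) - ((-q).toNat : ℤ) := by omega
    generalize hN : ((-q).toNat : ℤ) = N at *
    generalize hM : (q.toNat : ℤ) = M at *
    subst hq
    constructor <;> nlinarith
  · rintro ⟨N, M, h1, h2⟩
    exact ⟨M - N, by constructor <;> nlinarith⟩

theorem exists_negCls_eq (hk : 0 < k) (hl : 0 < l) (g : Grp k l) :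
    ∃ a c : ℕ, negCls k l (a + 1, c + 1) = g := by
  obtain ⟨⟨s, t⟩, rfl⟩ := QuotientAddGroup.mk_surjective g
  have hk' : (1 : ℤ) ≤ k := by exact_mod_cast hk
  have hl' : (1 : ℤ) ≤ l := by exact_mod_cast hl
  set q : ℤ := |s| + |t| + 1
  have hs := le_abs_self s
  have ht := le_abs_self t
  have hs0 := abs_nonneg s
  have ht0 := abs_nonneg t
  have h1 : 0 ≤ q * k - s - 1 := by nlinarith
  have h2 : 0 ≤ q * l - t - 1 := by nlinarith
  refine ⟨(q * k - s - 1).toNat, (q * l - t - 1).toNat, ?_⟩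
  change cls k l _ _ = cls k l s t
  rw [cls_eq_cls_iff]
  refine ⟨q, ?_, ?_⟩
  · push_cast
    rw [Int.toNat_of_nonneg h1]
    ring
  · push_cast
    rw [Int.toNat_of_nonneg h2]
    ring

variable {m n : ℕ} {θ : Equiv.Perm (Fin m × Fin n)} {ι H : Type*}
  [NormedAddCommGroup H] [InnerProductSpace ℂ H] [CompleteSpace H]
  {π : Semi θ →* (H →L[ℂ] H)} {b : HilbertBasis ι ℂ H}

theorem exists_isGrid (hs : IsStarRep π) (ha : IsAtomic π b) {x : ι}
    (hx : (hs.isCover ha).IsRecurrent k l x) : ∃ ξ i j, IsGrid π b x k l ξ i j := by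
  set h := hs.isCover ha
  -- the vertex at the class of `-d` is the pullback of `x` by `d`
  let ξ : Grp k l → ι := fun g =>
    h.back ((exists_negCls_eq hx.blue_pos hx.red_pos g).choose + 1,
      (exists_negCls_eq hx.blue_pos hx.red_pos g).choose_spec.choose + 1) x
  have hξ : ∀ d, ξ (negCls k l d) = h.back d x := fun d =>
    hx.back_eq_iff.2 (negCls_eq_iff.1
      (exists_negCls_eq hx.blue_pos hx.red_pos (negCls k l d)).choose_spec.choose_spec)
  have hblue : ∀ g, h.blueTail (ξ (g + cls k l 1 0)) = ξ g := by
    intro g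
    obtain ⟨a, c, rfl⟩ := exists_negCls_eq hx.blue_pos hx.red_pos g
    have : negCls k l (a + 1, c + 1) + cls k l 1 0 = negCls k l (a, c + 1) := by
      unfold negCls
      rw [cls_add]
      congr 1
      push_cast
      ring
    rw [this, hξ, hξ, h.back_succ_left]
  have hred : ∀ g, h.redTail (ξ (g + cls k l 0 1)) = ξ g := by
    intro g
    obtain ⟨a, c, rfl⟩ := exists_negCls_eq hx.blue_pos hx.red_pos g
    have : negCls k l (a + 1, c + 1) + cls k l 0 1 = negCls k l (a + 1, c) := by
      unfold negCls
      rw [cls_add]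
      congr 1
      push_cast
      ring
    rw [this, hξ, hξ, h.back_succ_right]
  refine ⟨ξ, fun g => h.blueLabel (ξ (g + cls k l 1 0)),
    fun g => h.redLabel (ξ (g + cls k l 0 1)), ?_, ?_, ?_, ?_⟩
  · intro g g' hgg
    obtain ⟨a, c, rfl⟩ := exists_negCls_eq hx.blue_pos hx.red_pos g
    obtain ⟨a', c', rfl⟩ := exists_negCls_eq hx.blue_pos hx.red_pos g'
    rw [hξ, hξ, hx.back_eq_iff] at hgg
    exact negCls_eq_iff.2 hgg
  · exact hξ 0
  · intro g
    rw [hs.carries_iff ha]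
    conv_lhs => rw [← hblue g]
    exact h.act_blueLabel _
  · intro g
    rw [hs.carries_iff ha]
    conv_lhs => rw [← hred g]
    exact h.act_redLabel _

/-- The labels around a square of the grid are related by `θ`. -/
theorem IsGrid.square (hs : IsStarRep π) (ha : IsAtomic π b) {x : ι} {ξ : Grp k l → ι}
    {i : Grp k l → Fin m} {j : Grp k l → Fin n} (hg : IsGrid π b x k l ξ i j) (s t : ℤ) :
    θ (i (cls k l s (t + 1)), j (cls k l s t)) = (i (cls k l s t), j (cls k l (s + 1) t)) := by
  have hblue : ∀ s t, hs.act ha (e θ (i (cls k l s t))) (ξ (cls k l s t))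
      = ξ (cls k l (s + 1) t) := by
    intro s t
    have := (hs.carries_iff ha).1 (hg.blue (cls k l s t))
    rwa [cls_add, add_zero] at this
  have hred : ∀ s t, hs.act ha (f θ (j (cls k l s t))) (ξ (cls k l s t))
      = ξ (cls k l s (t + 1)) := by
    intro s t
    have := (hs.carries_iff ha).1 (hg.red (cls k l s t))
    rwa [cls_add, add_zero] at this
  have h1 : hs.act ha (e θ (i (cls k l s (t + 1))) * f θ (j (cls k l s t))) (ξ (cls k l s t))
      = hs.act ha (f θ (j (cls k l (s + 1) t)) * e θ (i (cls k l s t))) (ξ (cls k l s t)) := by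
    rw [act_mul, act_mul, hred, hblue, hblue, hred]
  have h2 := ((hs.isCover ha).act_inj (by simp) h1).1
  rw [e_mul_f] at h2
  obtain ⟨h3, h4⟩ := f_mul_cancel h2
  have h5 : e θ (θ (i (cls k l s (t + 1)), j (cls k l s t))).1 * 1 = e θ (i (cls k l s t)) * 1 := by
    rw [mul_one, mul_one, h4]
  exact Prod.ext (e_mul_cancel h5).1 h3

end Grid

/-! ### Periodicity of labellings of a cylinder -/

section Period

variable {m n : ℕ} {θ : Equiv.Perm (Fin m × Fin n)} {k l : ℕ} {I : ℤ → ℤ → Fin m}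
  {J : ℤ → ℤ → Fin n}

/-- The labels on the loop through the column `s` (`l` red edges up the column, preceded by `k`
blue edges along the row `0`) coincide with those on the loop through the column `s'`. -/
def LoopsAgree (k l : ℕ) (I : ℤ → ℤ → Fin m) (J : ℤ → ℤ → Fin n) (s s' : ℤ) : Prop :=
  (∀ r : ℕ, r < k → I (s - (r + 1)) 0 = I (s' - (r + 1)) 0) ∧
    ∀ t : ℕ, t < l → J s t = J s' t

theorem LoopsAgree.pred (hk : 0 < k)
    (hI : ∀ s t, I (s + k) (t + l) = I s t)
    (hsq : ∀ s t, θ (I s (t + 1), J s t) = (I s t, J (s + 1) t)) {s s' : ℤ}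
    (h : LoopsAgree k l I J s s') : LoopsAgree k l I J (s - 1) (s' - 1) := by
  have step : ∀ t : ℕ, t < l → I (s - 1) t = I (s' - 1) t →
      I (s - 1) (t + 1) = I (s' - 1) (t + 1) ∧ J (s - 1) t = J (s' - 1) t := by
    intro t ht hI'
    refine Prod.ext_iff.1 (θ.injective ((hsq _ _).trans (Eq.trans ?_ (hsq _ _).symm)))
    rw [hI', sub_add_cancel, sub_add_cancel, h.2 t ht]
  have hrow : ∀ t : ℕ, t ≤ l → I (s - 1) t = I (s' - 1) t := by
    intro t
    induction t with
    | zero => intro _; simpa using h.1 0 hk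
    | succ t ih =>
      intro ht
      have := (step t (by omega) (ih (by omega))).1
      exact_mod_cast this
  refine ⟨fun r hr => ?_, fun t ht => (step t ht (hrow t ht.le)).2⟩
  rcases Nat.lt_or_ge (r + 1) k with hr' | hr'
  · have := h.1 (r + 1) hr'
    push_cast at this
    rw [show s - 1 - ((r : ℤ) + 1) = s - (r + 1 + 1) by ring,
      show s' - 1 - ((r : ℤ) + 1) = s' - (r + 1 + 1) by ring, this]
  · obtain rfl : k = r + 1 := by omega
    have := hrow l le_rfl
    rw [← hI, ← hI (s' - 1 - _)]
    push_cast
    simpa using this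

theorem LoopsAgree.succ (hk : 0 < k)
    (hI : ∀ s t, I (s + k) (t + l) = I s t)
    (hsq : ∀ s t, θ (I s (t + 1), J s t) = (I s t, J (s + 1) t)) {s s' : ℤ}
    (h : LoopsAgree k l I J s s') : LoopsAgree k l I J (s + 1) (s' + 1) := by
  have step : ∀ t : ℕ, t < l → I s (t + 1) = I s' (t + 1) →
      I s t = I s' t ∧ J (s + 1) t = J (s' + 1) t := by
    intro t ht hI'
    refine Prod.ext_iff.1 ((hsq _ _).symm.trans (Eq.trans ?_ (hsq _ _)))
    rw [hI', h.2 t ht]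
  have hrow : ∀ r : ℕ, ∀ t : ℕ, t + r = l → I s t = I s' t := by
    intro r
    induction r with
    | zero =>
      rintro t rfl
      have := h.1 (k - 1) (by omega)
      rw [← hI, ← hI (s' - _)] at this
      push_cast [Nat.cast_sub hk] at this
      simpa using this
    | succ r ih =>
      intro t ht
      refine (step t (by omega) ?_).1
      exact_mod_cast ih (t + 1) (by omega)
  refine ⟨fun r hr => ?_, fun t ht => (step t ht ?_).2⟩
  · rcases r with - | r
    · simpa using hrow l 0 (by omega)
    · have := h.1 r (by omega)
      push_cast
      simpa using this
  · exact_mod_cast hrow (l - (t + 1)) (t + 1) (by omega)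

/-- A labelling of the squares of a cylinder compatible with `θ` is periodic: the labels on a
loop determine all labels, and there are only finitely many labellings of a loop. -/
theorem exists_period (hk : 0 < k) (hl : 0 < l)
    (hI : ∀ s t, I (s + k) (t + l) = I s t) (hJ : ∀ s t, J (s + k) (t + l) = J s t)
    (hsq : ∀ s t, θ (I s (t + 1), J s t) = (I s t, J (s + 1) t)) :
    ∃ p : ℤ, 0 < p ∧ ∀ s t, I (s - p) t = I s t ∧ J (s - p) t = J s t := by
  obtain ⟨s₁, s₂, hne, hs⟩ : ∃ s₁ s₂ : ℤ, s₁ ≠ s₂ ∧ LoopsAgree k l I J s₁ s₂ := by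
    obtain ⟨s₁, s₂, hne, hs⟩ := Finite.exists_ne_map_eq_of_infinite
      fun s : ℤ => ((fun r : Fin k => I (s - ((r : ℕ) + 1)) 0, fun t : Fin l => J s (t : ℕ)) :
        (Fin k → Fin m) × (Fin l → Fin n))
    obtain ⟨h1, h2⟩ := Prod.ext_iff.1 hs
    exact ⟨s₁, s₂, hne, fun r hr => congrFun h1 ⟨r, hr⟩, fun t ht => congrFun h2 ⟨t, ht⟩⟩
  obtain ⟨p, hp, s₀, h₀⟩ : ∃ p : ℤ, 0 < p ∧ ∃ s, LoopsAgree k l I J (s - p) s := by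
    rcases lt_or_gt_of_ne hne with hlt | hlt
    · exact ⟨s₂ - s₁, by omega, s₂, by simpa using hs⟩
    · exact ⟨s₁ - s₂, by omega, s₁, by
        rw [sub_sub_cancel]
        exact ⟨fun r hr => (hs.1 r hr).symm, fun t ht => (hs.2 t ht).symm⟩⟩
  have hall : ∀ s, LoopsAgree k l I J (s - p) s := by
    intro s
    induction s using Int.inductionOn' (b := s₀) with
    | zero => exact h₀
    | succ s _ ih =>
      have := ih.succ hk hI hsq
      rwa [show s - p + 1 = s + 1 - p by ring] at this
    | pred s _ ih =>
      have := ih.pred hk hI hsq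
      rwa [show s - p - 1 = s - 1 - p by ring] at this
  have hrow : ∀ t : ℕ, t ≤ l → ∀ s, I (s - p) t = I s t := by
    intro t
    induction t with
    | zero =>
      intro _ s
      have := (hall (s + 1)).1 0 hk
      simpa [show s + 1 - p - 1 = s - p by ring] using this
    | succ t ih =>
      intro ht s
      have h1 := (hall s).2 t (by omega)
      have h2 := (hall (s + 1)).2 t (by omega)
      have h3 := ih (by omega) s
      have : θ (I (s - p) (t + 1), J (s - p) t) = θ (I s (t + 1), J s t) := by
        rw [hsq, hsq, h3, show s - p + 1 = s + 1 - p by ring, h2]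
      exact_mod_cast (Prod.ext_iff.1 (θ.injective this)).1
  -- every row is a translate of one of the rows `0, …, l - 1`
  have hper : ∀ {α : Type} (F : ℤ → ℤ → α), (∀ s t, F (s + k) (t + l) = F s t) →
      ∀ (q s t : ℤ), F (s + q * k) (t + q * l) = F s t := by
    intro α F hF q
    induction q using Int.induction_on with
    | zero => simp
    | succ q ih =>
      intro s t
      have := hF (s + q * k) (t + q * l)
      rw [ih] at this
      rw [← this]
      congr 1 <;> ring
    | pred q ih =>
      intro s t
      rw [← ih s t, ← hF]
      congr 1 <;> ring
  refine ⟨p, hp, fun s t => ?_⟩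
  have hl' : (0 : ℤ) < l := by exact_mod_cast hl
  obtain ⟨q, t₀, ht₀, rfl⟩ : ∃ (q : ℤ) (t₀ : ℕ), t₀ < l ∧ t = t₀ + q * l := by
    have h1 := Int.emod_nonneg t hl'.ne'
    have h2 := Int.emod_lt_of_pos t hl'
    refine ⟨t / l, (t % l).toNat, by omega, ?_⟩
    rw [Int.toNat_of_nonneg h1]
    linarith [Int.emod_add_mul_ediv t l]
  obtain ⟨s, rfl⟩ : ∃ s', s = s' + q * k := ⟨s - q * k, by ring⟩
  rw [show s + q * k - p = s - p + q * k by ring, hper I hI, hper I hI, hper J hJ, hper J hJ]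
  exact ⟨hrow t₀ ht₀.le s, (hall s).2 t₀ ht₀⟩

end Period

section Symmetry

variable {k l m n : ℕ} {θ : Equiv.Perm (Fin m × Fin n)} {ι H : Type*}
  [NormedAddCommGroup H] [InnerProductSpace ℂ H] [CompleteSpace H]
  {π : Semi θ →* (H →L[ℂ] H)} {b : HilbertBasis ι ℂ H}

theorem IsGrid.exists_period (hs : IsStarRep π) (ha : IsAtomic π b) (hk : 0 < k) (hl : 0 < l)
    {x : ι} {ξ : Grp k l → ι} {i : Grp k l → Fin m} {j : Grp k l → Fin n}
    (hg : IsGrid π b x k l ξ i j) :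
    ∃ p : ℤ, 0 < p ∧ ∀ s t : ℤ, i (cls k l (s - p) t) = i (cls k l s t) ∧
      j (cls k l (s - p) t) = j (cls k l s t) := by
  have hcls : ∀ s t : ℤ, cls k l (s + k) (t + l) = cls k l s t := fun s t =>
    (cls_eq_cls_iff.2 ⟨1, by simp⟩).symm
  exact TwoGraph.exists_period (θ := θ) (I := fun s t => i (cls k l s t))
    (J := fun s t => j (cls k l s t)) hk hl (fun s t => by rw [hcls]) (fun s t => by rw [hcls])
    (hg.square hs ha)

theorem symGroup_ne_bot (hl : 0 < l) {i : Grp k l → Fin m} {j : Grp k l → Fin n} {p : ℤ}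
    (hp : 0 < p) (h : ∀ s t : ℤ, i (cls k l (s - p) t) = i (cls k l s t) ∧
      j (cls k l (s - p) t) = j (cls k l s t)) : symGroup i j ≠ ⊥ := by
  intro hbot
  have hmem : cls k l p 0 ∈ symGroup i j := by
    refine ⟨0, fun s t _ _ => ?_⟩
    rw [cls_add, add_zero]
    have := h (s + p) t
    rw [add_sub_cancel_right] at this
    exact ⟨this.1.symm, this.2.symm⟩
  rw [hbot, AddSubgroup.mem_bot] at hmem
  obtain ⟨q, h1, h2⟩ := cls_eq_cls_iff.1 (show cls k l 0 0 = cls k l p 0 from hmem.symm)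
  have hq : q = 0 := by
    rcases mul_eq_zero.1 (show q * (l : ℤ) = 0 by linarith) with hq | hq
    · exact hq
    · exact absurd hq (by exact_mod_cast hl.ne')
  rw [hq] at h1
  omega

end Symmetry

/-! ### Reducibility -/

section Reducing

variable {H : Type*} [NormedAddCommGroup H] [InnerProductSpace ℂ H] [CompleteSpace H]

/-- A normal operator that is not a scalar has two spectral values, and continuous functions with
disjoint supports around them give two nonzero operators with product zero. -/
theorem exists_cfc_mul_eq_zero {T : H →L[ℂ] H} (hT : IsStarNormal T)
    (hns : ∀ c : ℂ, T ≠ c • (1 : H →L[ℂ] H)) :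
    ∃ F G : ℂ → ℂ, cfc F T ≠ 0 ∧ cfc G T ≠ 0 ∧ cfc F T * cfc G T = 0 := by
  obtain ⟨a, ha, c, hc, hac⟩ : (spectrum ℂ T).Nontrivial := by
    by_contra hsub
    rw [Set.not_nontrivial_iff] at hsub
    obtain ⟨a, ha⟩ : ∃ a : ℂ, ∀ z ∈ spectrum ℂ T, z = a := by
      rcases (spectrum ℂ T).eq_empty_or_nonempty with h | ⟨a, ha⟩
      · exact ⟨0, by simp [h]⟩
      · exact ⟨a, fun z hz => hsub hz ha⟩
    refine hns a ?_
    rw [← Algebra.algebraMap_eq_smul_one, ← cfc_const a T]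
    conv_lhs => rw [← cfc_id' ℂ T]
    exact cfc_congr ha
  have hr : 0 < dist a c / 2 := by
    have := dist_pos.2 hac
    positivity
  -- the tent function of radius half the distance, centred at a spectral value
  let F : ℂ → ℂ → ℂ := fun p z => ((max 0 (dist a c / 2 - dist z p) : ℝ) : ℂ)
  have hF : ∀ p, Continuous (F p) := fun p => by fun_prop
  have hne : ∀ p ∈ spectrum ℂ T, cfc (F p) T ≠ 0 := by
    intro p hp h0
    have hmem : F p p ∈ spectrum ℂ (cfc (F p) T) := by
      rw [cfc_map_spectrum (F p) T hT (hF p).continuousOn]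
      exact ⟨p, hp, rfl⟩
    rw [h0] at hmem
    have hnt : Nontrivial (H →L[ℂ] H) := by
      by_contra hnt
      rw [not_nontrivial_iff_subsingleton] at hnt
      exact hns 0 (Subsingleton.elim _ _)
    rw [spectrum.zero_eq, Set.mem_singleton_iff] at hmem
    simp only [F, dist_self, sub_zero, Complex.ofReal_eq_zero] at hmem
    rw [max_eq_right hr.le] at hmem
    exact hr.ne' hmem
  refine ⟨F a, F c, hne a ha, hne c hc, ?_⟩
  rw [← cfc_mul (F a) (F c) T (hF a).continuousOn (hF c).continuousOn]
  have : (fun z => F a z * F c z) = fun _ => 0 := by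
    funext z
    have htri := dist_triangle_left a c z
    rcases le_total (dist a c / 2) (dist z a) with h1 | h1
    · simp only [F]
      rw [max_eq_left (by linarith)]
      simp
    · simp only [F]
      rw [max_eq_left (b := dist a c / 2 - dist z c) (by linarith)]
      simp
  rw [this, cfc_const_zero]

variable {m n : ℕ} {θ : Equiv.Perm (Fin m × Fin n)} {ι : Type*}
  {π : Semi θ →* (H →L[ℂ] H)} {b : HilbertBasis ι ℂ H}

/-- A unitary operator in the commutant that is not a scalar makes a representation reducible: the
kernel of a suitable continuous function of it is a reducing subspace. -/
theorem not_isIrreducible_of_commute (U : H ≃ₗᵢ[ℂ] H) (hU : ∀ w η, U (π w η) = π w (U η))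
    (hns : ∀ c : ℂ, ∃ η, U η ≠ c • η) : ¬ IsIrreducible π := by
  intro hirr
  set T : H →L[ℂ] H := (U : H →L[ℂ] H) with hTdef
  have hTa : ∀ η, T η = U η := fun _ => rfl
  have hstar : star T = (U.symm : H →L[ℂ] H) := by
    rw [ContinuousLinearMap.star_eq_adjoint]
    refine (ContinuousLinearMap.eq_adjoint_iff _ _).2 (fun x y => ?_) |>.symm
    change inner ℂ (U.symm x) y = inner ℂ x (U y)
    rw [← U.inner_map_map, U.apply_symm_apply]
  have hsT : ∀ η, star T η = U.symm η := fun η => by rw [hstar]; rfl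
  have hT : IsStarNormal T := ⟨by
    ext η
    change star T (T η) = T (star T η)
    rw [hsT, hsT, hTa, hTa, U.symm_apply_apply, U.apply_symm_apply]⟩
  obtain ⟨F, G, hF, hG, hFG⟩ := exists_cfc_mul_eq_zero hT (by
    intro c hc
    obtain ⟨η, hη⟩ := hns c
    exact hη (congrArg (fun S => S η) hc))
  have hcomm : ∀ w, Commute T (π w) := fun w => by
    ext η
    exact hU w η
  have hcomm' : ∀ w, Commute (star T) (π w) := fun w => by
    ext η
    change star T (π w η) = π w (star T η)
    rw [hsT, hsT, U.symm_apply_eq, hU, U.apply_symm_apply]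
  have hcs : ∀ w, Commute T (star (π w)) := fun w => by
    simpa using (hcomm' w).star_star
  have hcs' : ∀ w, Commute (star T) (star (π w)) := fun w => (hcomm w).star_star
  have key : ∀ S, Commute T S → Commute (star T) S → ∀ η, cfc F T η = 0 → cfc F T (S η) = 0 := by
    intro S h1 h2 η hη
    have := congrArg (fun R => R η) ((h1.cfc h2 F).eq)
    change cfc F T (S η) = S (cfc F T η) at this
    rw [this, hη, map_zero]
  rcases hirr (LinearMap.ker (cfc F T : H →L[ℂ] H).toLinearMap)
    (cfc F T : H →L[ℂ] H).isClosed_ker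
    (fun w η hη => ⟨key _ (hcomm w) (hcomm' w) η hη, key _ (hcs w) (hcs' w) η hη⟩) with h | h
  · refine hG (ContinuousLinearMap.ext fun η => ?_)
    have : cfc G T η ∈ LinearMap.ker (cfc F T : H →L[ℂ] H).toLinearMap :=
      congrArg (fun R : H →L[ℂ] H => R η) hFG
    rw [h] at this
    exact this
  · refine hF (ContinuousLinearMap.ext fun η => ?_)
    have : η ∈ LinearMap.ker (cfc F T : H →L[ℂ] H).toLinearMap := h ▸ Submodule.mem_top
    exact this

/-- Data move down along blue edges: a loop `e_i r` at `x` turns into the loop `r e_i` at the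
tail of the edge `e_i`, with the same scalar. -/
theorem HasData.exists_blueTail {u₀ : List (Fin m)} {v₀ : List (Fin n)} {β : Circle} {x : ι}
    (hx : HasData π b u₀ v₀ β x) (hπ : IsType3bi π b) :
    ∃ u₁ v₁, u₁.length = u₀.length ∧ v₁.length = v₀.length ∧
      HasData π b u₁ v₁ β ((hπ.starRep.isCover hπ.atomic).blueTail x) := by
  have hs := hπ.starRep
  have ha := hπ.atomic
  set h := hπ.starRep.isCover hπ.atomic
  have hrec := hx.isRecurrent hπ
  have hrec' := hrec.blueTail
  obtain ⟨i, r, hr⟩ := exists_eq_e_mul (w := eWord θ u₀ * fWord θ v₀)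
    (by simpa using hx.ne_nil)
  have hdeg : deg (r * e θ i) = (u₀.length, v₀.length) := by
    have := congrArg deg hr
    rw [deg_mul, deg_mul, add_comm (deg (e θ i)), ← deg_mul] at this
    rw [deg_mul, ← this]
    simp
  have hact := hx.act_eq hs ha
  rw [hr, act_mul] at hact
  have htail : hs.act ha r x = h.blueTail x := by
    conv_rhs => rw [← hact]
    rw [h.blueTail_act]
  rw [htail] at hact
  obtain ⟨c, hc, hcx⟩ := (hs.carries_iff ha).2 hact
  -- the blue isometry can be cancelled in `π(e_i) π(r) ξ = β ξ`
  have hrx : π r (b x) = ((β : ℂ) * c⁻¹) • b (h.blueTail x) := by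
    refine (hs.isometry (e θ i)).injective ?_
    rw [← rep_mul_apply, ← hr, hx.eigen, map_smul, hcx, smul_smul, mul_assoc, inv_mul_cancel₀ hc,
      mul_one]
  have heig : π (r * e θ i) (b (h.blueTail x)) = (β : ℂ) • b (h.blueTail x) := by
    rw [rep_mul_apply, hcx, map_smul, hrx, smul_smul, mul_comm (β : ℂ), mul_inv_cancel_left₀ hc]
  have hper : HasBluePeriod π b (h.blueTail x) v₀.length :=
    (hasBluePeriod_iff hs ha).2
      ⟨⟨hrec'.red_pos, u₀.length, 0, hrec'.loop⟩, hrec'.least⟩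
  obtain ⟨u₁, v₁, β', hu, hv, hβ, hd⟩ := hasData_of_eigen hs hrec'.blue_pos hdeg hper heig
  obtain rfl : β' = β := Circle.ext hβ
  exact ⟨u₁, v₁, hu, hv, hd⟩

theorem IsType3bi.not_isIrreducible (hπ : IsType3bi π b) : ¬ IsIrreducible π := by
  obtain ⟨u₀, v₀, β, x, hx⟩ := hπ.exists_hasData
  set h := hπ.starRep.isCover hπ.atomic
  have hdata : ∀ a : ℕ, ∃ u v, u.length = u₀.length ∧ v.length = v₀.length ∧
      HasData π b u v β (h.back (a, 0) x) := by
    intro a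
    induction a with
    | zero => exact ⟨u₀, v₀, rfl, rfl, hx⟩
    | succ a ih =>
      obtain ⟨u, v, hu, hv, hd⟩ := ih
      obtain ⟨u₁, v₁, hu₁, hv₁, hd₁⟩ := hd.exists_blueTail hπ
      refine ⟨u₁, v₁, hu₁.trans hu, hv₁.trans hv, ?_⟩
      rwa [h.back_succ_left]
  choose u v hu hv hd using hdata
  -- only finitely many pairs of words occur, so the data at two different vertices coincide
  obtain ⟨a, a', hne, heq⟩ := Finite.exists_ne_map_eq_of_infinite
    fun a : ℕ => ((⟨u a, hu a⟩, ⟨v a, hv a⟩) :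
      List.Vector (Fin m) u₀.length × List.Vector (Fin n) v₀.length)
  obtain ⟨hu', hv'⟩ := Prod.ext_iff.1 heq
  have hd' := hd a'
  rw [← show u a = u a' from congrArg Subtype.val hu',
    ← show v a = v a' from congrArg Subtype.val hv'] at hd'
  obtain ⟨U, hUx, hU⟩ := exists_unitary hπ hπ (hd a) hd'
  refine not_isIrreducible_of_commute U hU fun c => ⟨b (h.back (a, 0) x), fun hc => ?_⟩
  rw [hUx] at hc
  refine hne (hπ.tail x ?_)
  exact (basis_eq_of_smul_eq b one_ne_zero ((one_smul ℂ _).trans hc)).symm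

end Reducing

/-! ### Representations with prescribed data -/

section Model

variable {m n : ℕ} {θ : Equiv.Perm (Fin m × Fin n)}

/-- Two elements of `𝔽_θ⁺` are identified if they become equal after finitely many right
multiplications by `z`. -/
def loopSetoid (z : Semi θ) : Setoid (Semi θ) where
  r w w' := ∃ N M : ℕ, w * z ^ N = w' * z ^ M
  iseqv :=
    { refl := fun _ => ⟨0, 0, rfl⟩
      symm := fun ⟨N, M, h⟩ => ⟨M, N, h.symm⟩
      trans := fun {w w' w''} ⟨N, M, h⟩ ⟨N', M', h'⟩ => ⟨N + N', M' + M, by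
        rw [pow_add, ← mul_assoc, h, mul_assoc, ← pow_add, add_comm M, pow_add, ← mul_assoc, h',
          mul_assoc, ← pow_add]⟩ }

/-- The vertices of the representation with loop `z`: the quotient of `𝔽_θ⁺` by
`w z ∼ w`. -/
def LoopVertex (z : Semi θ) : Type := Quotient (loopSetoid z)

/-- The action of `𝔽_θ⁺` on `LoopVertex z` by left multiplication. -/
def loopAct (z : Semi θ) : Semi θ →* Function.End (LoopVertex z) where
  toFun w := Quotient.map (w * ·) fun w₁ w₂ ⟨N, M, h⟩ => ⟨N, M, by
    simp only [mul_assoc, h]⟩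
  map_one' := by
    funext x
    induction x using Quotient.inductionOn with
    | h w => exact congrArg _ (one_mul w)
  map_mul' w₁ w₂ := by
    funext x
    induction x using Quotient.inductionOn with
    | h w => exact congrArg _ (mul_assoc w₁ w₂ w)

/-- The vertex of `LoopVertex z` at which `z` is a loop. -/
def loopBase (z : Semi θ) : LoopVertex z := Quotient.mk _ 1

theorem loopAct_loopBase (z w : Semi θ) :
    loopAct z w (loopBase z) = Quotient.mk (loopSetoid z) w :=
  congrArg (Quotient.mk (loopSetoid z)) (mul_one w)

theorem loopAct_self (z : Semi θ) : loopAct z z (loopBase z) = loopBase z := by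
  rw [loopAct_loopBase]
  exact Quotient.sound ⟨0, 1, by simp⟩

theorem loopVertex_mk_mul (z w : Semi θ) :
    Quotient.mk (loopSetoid z) (w * z) = Quotient.mk (loopSetoid z) w :=
  Quotient.sound ⟨0, 1, by simp⟩

theorem isCover_loopAct {z : Semi θ} (h1 : (deg z).1 ≠ 0) (h2 : (deg z).2 ≠ 0) :
    IsCover (loopAct z) where
  blue := by
    constructor
    · rintro ⟨i, x⟩ ⟨i', x'⟩ h
      induction x using Quotient.inductionOn with | h w
      induction x' using Quotient.inductionOn with | h w'
      obtain ⟨N, M, h⟩ := Quotient.exact h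
      change e θ i * w * z ^ N = e θ i' * w' * z ^ M at h
      rw [mul_assoc, mul_assoc] at h
      obtain ⟨rfl, h'⟩ := e_mul_cancel h
      exact Prod.ext rfl (Quotient.sound ⟨N, M, h'⟩)
    · intro x
      induction x using Quotient.inductionOn with | h w
      obtain ⟨i, r, hr⟩ := exists_eq_e_mul (w := w * z) (by simp [h1])
      exact ⟨(i, Quotient.mk _ r), (congrArg (Quotient.mk _) hr.symm).trans
        (loopVertex_mk_mul z w)⟩
  red := by
    constructor
    · rintro ⟨j, x⟩ ⟨j', x'⟩ h
      induction x using Quotient.inductionOn with | h w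
      induction x' using Quotient.inductionOn with | h w'
      obtain ⟨N, M, h⟩ := Quotient.exact h
      change f θ j * w * z ^ N = f θ j' * w' * z ^ M at h
      rw [mul_assoc, mul_assoc] at h
      obtain ⟨rfl, h'⟩ := f_mul_cancel h
      exact Prod.ext rfl (Quotient.sound ⟨N, M, h'⟩)
    · intro x
      induction x using Quotient.inductionOn with | h w
      obtain ⟨j, r, hr⟩ := exists_eq_f_mul (w := w * z) (by simp [h2])
      exact ⟨(j, Quotient.mk _ r), (congrArg (Quotient.mk _) hr.symm).trans
        (loopVertex_mk_mul z w)⟩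

variable {k l : ℕ}

/-- The degree modulo `(k, l)`. -/
def degCls (k l : ℕ) (w : Semi θ) : Grp k l := cls k l (deg w).1 (deg w).2

theorem degCls_mul (w w' : Semi θ) : degCls k l (w * w') = degCls k l w + degCls k l w' := by
  simp [degCls, cls_add]

theorem degCls_loop {z : Semi θ} (hz : deg z = (k, l)) : degCls k l z = 0 := by
  rw [degCls, hz]
  exact (cls_eq_cls_iff (s := 0) (t := 0).2 ⟨1, by simp⟩).symm

/-- The degree of a vertex, modulo the degree `(k, l)` of the loop `z`. -/
def loopVertexDeg {z : Semi θ} (hz : deg z = (k, l)) : LoopVertex z → Grp k l :=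
  Quotient.lift (degCls k l) fun w w' ⟨N, M, h⟩ => by
    have hp : ∀ N : ℕ, degCls k l (z ^ N) = 0 := by
      intro N
      induction N with
      | zero => rw [pow_zero, degCls, deg_one]; rfl
      | succ N ih => rw [pow_succ, degCls_mul, ih, degCls_loop hz, add_zero]
    have := congrArg (degCls k l) h
    rwa [degCls_mul, degCls_mul, hp, hp, add_zero, add_zero] at this

theorem loopVertexDeg_loopAct {z : Semi θ} (hz : deg z = (k, l)) (w : Semi θ)
    (x : LoopVertex z) :
    loopVertexDeg hz (loopAct z w x) = degCls k l w + loopVertexDeg hz x := by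
  induction x using Quotient.inductionOn with
  | h w' => exact degCls_mul w w'

variable {ι H : Type*} [NormedAddCommGroup H] [InnerProductSpace ℂ H]

/-- An injection of the index set of an orthonormal basis induces an isometry. -/
theorem exists_isometry (b : HilbertBasis ι ℂ H) [CompleteSpace H] {σ : ι → ι}
    (hσ : Function.Injective σ) : ∃ T : H →ₗᵢ[ℂ] H, ∀ x, T (b x) = b (σ x) := by
  classical
  have ho : Orthonormal ℂ (fun x => b (σ x)) := b.orthonormal.comp σ hσ
  refine ⟨ho.orthogonalFamily.linearIsometry.comp b.repr.toLinearIsometry, fun x => ?_⟩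
  change ho.orthogonalFamily.linearIsometry (b.repr (b x)) = _
  rw [b.repr_self, OrthogonalFamily.linearIsometry_apply_single]
  simp

variable [CompleteSpace H]

/-- Isometries that permute a basis up to scalars have defect zero if every basis vector is hit
exactly once. -/
theorem defect_of_bijective {N : ℕ} {A : Fin N → H →L[ℂ] H} {σ : Fin N → ι → ι}
    (b : HilbertBasis ι ℂ H) (hA : ∀ i η, ‖A i η‖ = ‖η‖)
    (hσ : ∀ i x, ∃ c : ℂ, c ≠ 0 ∧ A i (b x) = c • b (σ i x))
    (hbij : Function.Bijective fun p : Fin N × ι => σ p.1 p.2) :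
    ∑ i, A i ∘L ContinuousLinearMap.adjoint (A i) = 1 := by
  refine continuousLinearMap_ext_basis b fun y => ?_
  obtain ⟨⟨i₀, x⟩, rfl⟩ := hbij.2 y
  obtain ⟨c, hc, h⟩ := hσ i₀ x
  have hAA : ContinuousLinearMap.adjoint (A i₀) (A i₀ (b x)) = b x :=
    congrArg (fun T => T (b x))
      ((ContinuousLinearMap.norm_map_iff_adjoint_comp_self (A i₀)).1 (hA i₀))
  rw [sum_apply, Finset.sum_eq_single i₀]
  · change A i₀ (ContinuousLinearMap.adjoint (A i₀) (b (σ i₀ x))) = b (σ i₀ x)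
    have : b (σ i₀ x) = c⁻¹ • A i₀ (b x) := by rw [h, inv_smul_smul₀ hc]
    rw [this, map_smul, hAA, map_smul]
  · intro i _ hi
    have : ContinuousLinearMap.adjoint (A i) (b (σ i₀ x)) = 0 := by
      refine eq_zero_of_inner_basis b fun x' => ?_
      obtain ⟨c', -, h'⟩ := hσ i x'
      have hne : σ i x' ≠ σ i₀ x := fun heq =>
        hi (Prod.ext_iff.1 (hbij.1 (a₁ := (i, x')) (a₂ := (i₀, x)) heq)).1
      rw [ContinuousLinearMap.adjoint_inner_right, h', inner_smul_left, basis_inner_ne b hne,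
        mul_zero]
    change A i (ContinuousLinearMap.adjoint (A i) (b (σ i₀ x))) = 0
    rw [this, map_zero]
  · simp

/-- An action with unique incoming edges is implemented on a basis by an atomic representation in
which every blue edge carries the scalar `γ` and every red edge the scalar `1`. -/
theorem exists_isStarRep (b : HilbertBasis ι ℂ H) {act : Semi θ →* Function.End ι}
    (h : IsCover act) {γ : ℂ} (hγ : ‖γ‖ = 1) :
    ∃ π : Semi θ →* (H →L[ℂ] H), IsStarRep π ∧
      ∀ w x, π w (b x) = γ ^ (deg w).1 • b (act w x) := by
  have hinj : ∀ w, Function.Injective (act w) := fun w x x' hx => (h.act_inj rfl hx).2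
  choose T hT using fun w => exists_isometry b (hinj w)
  have hγ0 : γ ≠ 0 := norm_ne_zero_iff.1 (by rw [hγ]; exact one_ne_zero)
  let π : Semi θ →* (H →L[ℂ] H) :=
    { toFun := fun w => γ ^ (deg w).1 • (T w).toContinuousLinearMap
      map_one' := by
        refine continuousLinearMap_ext_basis b fun x => ?_
        change γ ^ (deg (1 : Semi θ)).1 • T 1 (b x) = b x
        rw [hT, act_one, deg_one]
        simp
      map_mul' := fun w w' => by
        refine continuousLinearMap_ext_basis b fun x => ?_
        change γ ^ (deg (w * w')).1 • T (w * w') (b x)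
          = γ ^ (deg w).1 • T w (γ ^ (deg w').1 • T w' (b x))
        rw [hT, hT, map_smul, hT, act_mul, smul_smul, deg_mul, Prod.fst_add, pow_add] }
  have hπ : ∀ w x, π w (b x) = γ ^ (deg w).1 • b (act w x) := by
    intro w x
    change γ ^ (deg w).1 • T w (b x) = _
    rw [hT]
  have hnorm : ∀ w η, ‖π w η‖ = ‖η‖ := by
    intro w η
    change ‖γ ^ (deg w).1 • T w η‖ = _
    rw [norm_smul, norm_pow, hγ, one_pow, one_mul, (T w).norm_map]
  refine ⟨π, ⟨fun w => (AddMonoidHomClass.isometry_iff_norm (π w)).2 (hnorm w), ?_, ?_⟩, hπ⟩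
  · exact defect_of_bijective b (fun i => hnorm _)
      (fun i x => ⟨_, pow_ne_zero _ hγ0, hπ (e θ i) x⟩) h.blue
  · exact defect_of_bijective b (fun j => hnorm _)
      (fun j x => ⟨_, pow_ne_zero _ hγ0, hπ (f θ j) x⟩) h.red

variable {π : Semi θ →* (H →L[ℂ] H)} {b : HilbertBasis ι ℂ H}

/-- If the vertices carry a degree modulo `(k, l)` and are all reached from a vertex `o` with a
loop of degree `(k, l)`, then the representation is of type 3bi with exact period `l` at `o`. -/
theorem isType3bi_of_degree (hs : IsStarRep π) (ha : IsAtomic π b) (hk : 0 < k) (hl : 0 < l)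
    (D : ι → Grp k l) (hD : ∀ w x, D (hs.act ha w x) = degCls k l w + D x) {o : ι}
    (ho : ∀ x, ∃ w, hs.act ha w o = x) {z : Semi θ} (hdz : deg z = (k, l))
    (hz : hs.act ha z o = o) : IsType3bi π b ∧ HasBluePeriod π b o l := by
  set h := hs.isCover ha
  have hDb : ∀ d d' x, h.back d x = h.back d' x →
      ∃ q : ℤ, (d'.1 : ℤ) = d.1 + q * k ∧ (d'.2 : ℤ) = d.2 + q * l := by
    intro d d' x hdd
    obtain ⟨w, hw, hwx⟩ := h.exists_act_back d x
    obtain ⟨w', hw', hwx'⟩ := h.exists_act_back d' x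
    have h1 := hD w (h.back d x)
    have h2 := hD w' (h.back d' x)
    rw [hwx] at h1
    rw [hwx', ← hdd, h1] at h2
    have h3 := add_right_cancel h2
    rw [degCls, degCls, hw, hw'] at h3
    exact cls_eq_cls_iff.1 h3
  have hper : HasBluePeriod π b o l := by
    refine (hasBluePeriod_iff hs ha).2 ⟨⟨hl, k, 0, ?_⟩, fun r hr hrl a a' heq => ?_⟩
    · have := h.back_deg z o
      rwa [hz, hdz] at this
    · obtain ⟨q, -, hq⟩ := hDb _ _ _ heq
      push_cast at hq
      have h1 : (l : ℤ) ∣ r := ⟨-q, by linarith⟩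
      exact absurd (Nat.le_of_dvd hr (Int.natCast_dvd_natCast.1 h1)) (by omega)
  refine ⟨⟨hs, ha, ⟨⟨o⟩, ?_⟩, ?_, ?_, ?_⟩, hper⟩
  · have hcon : ∀ w, Relation.EqvGen (fun x y => BlueEdge π b x y ∨ RedEdge π b x y) o
        (hs.act ha w o) := by
      intro w
      induction w using semi_induction with
      | one => rw [act_one]; exact .refl o
      | he i w ih =>
        rw [act_mul]
        exact .trans _ _ _ ih (.rel _ _ (.inl ⟨i, hs.carries_act ha _ _⟩))
      | hf j w ih =>
        rw [act_mul]
        exact .trans _ _ _ ih (.rel _ _ (.inr ⟨j, hs.carries_act ha _ _⟩))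
    intro x y
    obtain ⟨w, rfl⟩ := ho x
    obtain ⟨w', rfl⟩ := ho y
    exact .trans _ _ _ (.symm _ _ (hcon w)) (hcon w')
  · refine fun x => ⟨fun a => h.back (a, 0) x, rfl, fun a a' haa => ?_, fun a => ?_⟩
    · obtain ⟨q, h1, h2⟩ := hDb _ _ _ haa
      obtain rfl : q = 0 := by
        rcases mul_eq_zero.1 (show q * (l : ℤ) = 0 by push_cast at h2; linarith) with hq | hq
        · exact hq
        · omega
      simpa using h1.symm
    · exact ⟨h.blueLabel (h.back (a, 0) x), (hs.carries_iff ha).2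
        ((congrArg _ (h.back_succ_left a 0 x)).trans (h.act_blueLabel _))⟩
  · refine fun x => ⟨fun a => h.back (0, a) x, rfl, fun a a' haa => ?_, fun a => ?_⟩
    · obtain ⟨q, h1, h2⟩ := hDb _ _ _ haa
      obtain rfl : q = 0 := by
        rcases mul_eq_zero.1 (show q * (k : ℤ) = 0 by push_cast at h1; linarith) with hq | hq
        · exact hq
        · omega
      simpa using h2.symm
    · exact ⟨h.redLabel (h.back (0, a) x), (hs.carries_iff ha).2
        ((congrArg _ (h.back_succ_right 0 a x)).trans (h.act_redLabel _))⟩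
  · -- write the loop with its red letters in front
    obtain ⟨u, v, rfl⟩ := exists_eq_eWord_mul_fWord z
    obtain ⟨u', v', hu, hv, huv⟩ := eWord_mul_fWord (θ := θ) u v
    simp only [deg_mul, deg_eWord, deg_fWord, Prod.mk_add_mk, add_zero, zero_add,
      Prod.mk.injEq] at hdz
    refine ⟨o, hs.act ha (eWord θ u') o, u', v', ?_, ?_, hs.carries_act ha _ _,
      (hs.carries_iff ha).2 ?_⟩
    · rw [← List.length_pos_iff]
      omega
    · rwa [hv, hdz.2]
    · rw [← act_mul, ← huv, hz]

theorem exists_isType3bi (θ : Equiv.Perm (Fin m × Fin n)) (u₀ : List (Fin m)) (v₀ : List (Fin n))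
    (β : Circle) (hu : u₀ ≠ []) (hv : v₀ ≠ []) :
    ∃ (ι H : Type) (_ : NormedAddCommGroup H) (_ : InnerProductSpace ℂ H)
      (_ : CompleteSpace H) (π : Semi θ →* (H →L[ℂ] H)) (b : HilbertBasis ι ℂ H) (x : ι),
      IsType3bi π b ∧ HasData π b u₀ v₀ β x := by
  have hk := List.length_pos_iff.2 hu
  have hl := List.length_pos_iff.2 hv
  -- the blue edges share the scalar `β` evenly
  obtain ⟨γ, hγ⟩ := IsAlgClosed.exists_pow_nat_eq (β : ℂ) hk
  have hγ1 : ‖γ‖ = 1 := by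
    have := congrArg norm hγ
    rw [norm_pow, Circle.norm_coe] at this
    exact (pow_eq_one_iff_of_nonneg (norm_nonneg _) hk.ne').1 this
  have hγ0 : γ ≠ 0 := norm_ne_zero_iff.1 (by rw [hγ1]; exact one_ne_zero)
  set z : Semi θ := eWord θ u₀ * fWord θ v₀ with hzdef
  have hdz : deg z = (u₀.length, v₀.length) := by simp [z]
  let b : HilbertBasis (LoopVertex z) ℂ (lp (fun _ : LoopVertex z => ℂ) 2) :=
    HilbertBasis.ofRepr (LinearIsometryEquiv.refl ℂ _)
  obtain ⟨π, hs, hπ⟩ := exists_isStarRep b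
    (isCover_loopAct (z := z) (by rw [hdz]; exact hk.ne') (by rw [hdz]; exact hl.ne')) hγ1
  have ha : IsAtomic π b := fun w x =>
    ⟨_, _, Or.inl (by rw [norm_pow, hγ1, one_pow]), hπ w x⟩
  have hact : ∀ w x, hs.act ha w x = loopAct z w x := fun w x =>
    (hs.carries_iff ha).1 ⟨_, pow_ne_zero _ hγ0, hπ w x⟩
  obtain ⟨h3, hper⟩ := isType3bi_of_degree hs ha hk hl (loopVertexDeg hdz)
    (fun w x => by rw [hact, loopVertexDeg_loopAct]) (o := loopBase z)
    (fun x => by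
      induction x using Quotient.inductionOn with
      | h w => exact ⟨w, by rw [hact, loopAct_loopBase]⟩)
    hdz (by rw [hact, loopAct_self])
  refine ⟨LoopVertex z, _, inferInstance, inferInstance, inferInstance, π, b, loopBase z, h3, hu,
    hper, ?_⟩
  rw [← hzdef, hπ, loopAct_self, hdz, hγ]

end Model

end TwoGraph

end

theorem mainTheorem11 {m n : ℕ} (θ : Equiv.Perm (Fin m × Fin n)) :
    -- every representation of type 3bi has data `(u₀, v₀, β)`; the labels of its grid have a
    -- global shift symmetry, its symmetry group is nonzero, and it is not irreducible
    (∀ (ι H : Type*) [NormedAddCommGroup H] [InnerProductSpace ℂ H] [CompleteSpace H]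
        (π : TwoGraph.Semi θ →* (H →L[ℂ] H)) (b : HilbertBasis ι ℂ H),
        TwoGraph.IsType3bi π b →
          (∃ (u₀ : List (Fin m)) (v₀ : List (Fin n)) (β : Circle) (x : ι),
            TwoGraph.HasData π b u₀ v₀ β x) ∧
          (∀ (u₀ : List (Fin m)) (v₀ : List (Fin n)) (β : Circle) (x : ι),
            TwoGraph.HasData π b u₀ v₀ β x →
              (∃ ξ i j, TwoGraph.IsGrid π b x u₀.length v₀.length ξ i j) ∧
              (∀ ξ i j, TwoGraph.IsGrid π b x u₀.length v₀.length ξ i j →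
                (∃ p : ℤ, 0 < p ∧ ∀ s t : ℤ,
                  i (TwoGraph.cls u₀.length v₀.length (s - p) t)
                      = i (TwoGraph.cls u₀.length v₀.length s t) ∧
                  j (TwoGraph.cls u₀.length v₀.length (s - p) t)
                      = j (TwoGraph.cls u₀.length v₀.length s t)) ∧
                TwoGraph.symGroup i j ≠ ⊥)) ∧
          ¬ TwoGraph.IsIrreducible π) ∧
    -- the data determine the representation up to unitary equivalence
    (∀ (ι H ι' H' : Type*) [NormedAddCommGroup H] [InnerProductSpace ℂ H] [CompleteSpace H]
        [NormedAddCommGroup H'] [InnerProductSpace ℂ H'] [CompleteSpace H']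
        (π : TwoGraph.Semi θ →* (H →L[ℂ] H)) (b : HilbertBasis ι ℂ H)
        (π' : TwoGraph.Semi θ →* (H' →L[ℂ] H')) (b' : HilbertBasis ι' ℂ H')
        (u₀ : List (Fin m)) (v₀ : List (Fin n)) (β : Circle) (x : ι) (x' : ι'),
        TwoGraph.IsType3bi π b → TwoGraph.IsType3bi π' b' →
        TwoGraph.HasData π b u₀ v₀ β x → TwoGraph.HasData π' b' u₀ v₀ β x' →
          ∃ U : H ≃ₗᵢ[ℂ] H', U (b x) = b' x' ∧ ∀ w η, U (π w η) = π' w (U η)) ∧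
    -- every triple of two nonempty words and a unimodular scalar occurs
    (∀ (u₀ : List (Fin m)) (v₀ : List (Fin n)) (β : Circle), u₀ ≠ [] → v₀ ≠ [] →
        ∃ (ι H : Type) (_ : NormedAddCommGroup H) (_ : InnerProductSpace ℂ H)
          (_ : CompleteSpace H) (π : TwoGraph.Semi θ →* (H →L[ℂ] H))
          (b : HilbertBasis ι ℂ H) (x : ι),
          TwoGraph.IsType3bi π b ∧ TwoGraph.HasData π b u₀ v₀ β x) := by
  refine ⟨?_, ?_, ?_⟩
  · intro ι H _ _ _ π b hπ
    refine ⟨hπ.exists_hasData, fun u₀ v₀ β x hx => ?_, hπ.not_isIrreducible⟩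
    have hrec := hx.isRecurrent hπ
    refine ⟨TwoGraph.exists_isGrid hπ.starRep hπ.atomic hrec, fun ξ i j hg => ?_⟩
    obtain ⟨p, hp, hper⟩ :=
      hg.exists_period hπ.starRep hπ.atomic hrec.blue_pos hrec.red_pos
    exact ⟨⟨p, hp, hper⟩, TwoGraph.symGroup_ne_bot hrec.red_pos hp hper⟩
  · intro ι H ι' H' _ _ _ _ _ _ π b π' b' u₀ v₀ β x x' hπ hπ' hx hx'
    exact TwoGraph.exists_unitary hπ hπ' hx hx'
  · exact TwoGraph.exists_isType3bi θ
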